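/- For every integer $n\ge 2$ and every $\delta>0$ there exist constants $\lambda,\Lambda>0$, a measurable coefficient matrix $A:\mathbb{R}^n\times\mathbb{R}\to\mathbb{C}^{n\times n}$ satisfying $$\mathrm{Re}\Big(\sum_{k,l}A_{kl}(x,t)\,p_k\overline{p_l}\Big)\ge\lambda|p|^2,\qquad |A(x,t)p|^2\le\Lambda^2|p|^2\qquad\text{for all }(x,t)\in\mathbb{R}^{n}\times\mathbb{R},\ p\in\mathbb{C}^n,$$ and a function $u:\mathbb{R}^n\times\mathbb{R}\to\mathbb{C}$ with $u,\nabla u\in L^2_{loc}(\mathbb{R}^{n+1})$ (where $\nabla u$ is the weak gradient in $x$), which solves $u_t-\mathrm{div}(A\nabla u)=0$ on $\mathbb{R}^{n+1}$ in the sense of distributions, such that the following holds. The map $t\mapsto u(\cdot,t)$ is continuous from $(-\infty,0)$ to $L^2_{loc}(\mathbb{R}^n)$; for every $t>0$ the norms $\|u(\cdot,-t)\|_{L^{2+\delta}(B_1)}$ and $\|\nabla u\|_{L^{2+\delta}(B_1\times(-1,-t))}$ are finite; and $$\lim_{t\to0^+}\|u(\cdot,-t)\|_{L^{2+\delta}(B_1)}=\infty,\qquad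 \lim_{t\to0^+}\|\nabla u\|_{L^{2+\delta}(B_1\times(-1,-t))}=\infty .$$ Here $B_1$ is the unit ball of $\mathbb{R}^n$ centred at $0$. -/

import Mathlib

open MeasureTheory Set Filter Topology
open scoped ContDiff ENNReal

/-- Points `x` of `ℝⁿ`, with the Euclidean norm. -/
abbrev Space (n : ℕ) : Type := EuclideanSpace ℝ (Fin n)

/-- Points `(x, t)` of `ℝⁿ × ℝ = ℝⁿ⁺¹`, with Lebesgue measure. -/
abbrev SpaceTime (n : ℕ) : Type := Space n × ℝ

/-- Bounded measurable complex coefficients that are uniformly elliptic with constants `lam`, `Lam`: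
`Re (A_{kl}(z) p_k conj p_l) ≥ lam |p|²` and `|A(z) p|² ≤ Lam² |p|²` for all `z = (x, t)` and all
`p ∈ ℂⁿ`. -/
structure IsElliptic {n : ℕ} (A : SpaceTime n → Matrix (Fin n) (Fin n) ℂ) (lam Lam : ℝ) :
    Prop where
  measurable : ∀ k l, Measurable fun z => A z k l
  coercive : ∀ (z : SpaceTime n) (p : Fin n → ℂ),
    lam * ∑ k, ‖p k‖ ^ 2 ≤ (∑ k, ∑ l, A z k l * p k * (starRingEnd ℂ) (p l)).re
  bounded : ∀ (z : SpaceTime n) (p : Fin n → ℂ),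
    ∑ k, ‖∑ l, A z k l * p l‖ ^ 2 ≤ Lam ^ 2 * ∑ k, ‖p k‖ ^ 2

/-- Smooth compactly supported complex-valued functions on `ℝⁿ⁺¹`. -/
structure IsTestFunction {n : ℕ} (φ : SpaceTime n → ℂ) : Prop where
  smooth : ContDiff ℝ ∞ φ
  compactSupport : HasCompactSupport φ

/-- The spatial partial derivative `∂φ/∂x_k`. -/
noncomputable def spaceDeriv {n : ℕ} (k : Fin n) (φ : SpaceTime n → ℂ) (z : SpaceTime n) : ℂ :=
  fderiv ℝ φ z (EuclideanSpace.single k 1, 0)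

/-- The time derivative `∂φ/∂t`. -/
noncomputable def timeDeriv {n : ℕ} (φ : SpaceTime n → ℂ) (z : SpaceTime n) : ℂ :=
  fderiv ℝ φ z (0, 1)

/-- `u` lies in `L²_{loc,t}(H¹_{loc,x})` on `ℝⁿ⁺¹` and `G` is its weak spatial gradient `∇u`. -/
structure HasWeakSpatialGradient {n : ℕ} (u : SpaceTime n → ℂ)
    (G : SpaceTime n → EuclideanSpace ℂ (Fin n)) : Prop where
  memLp : ∀ K : Set (SpaceTime n), IsCompact K → MemLp u 2 (volume.restrict K)
  memLp_grad : ∀ K : Set (SpaceTime n), IsCompact K → MemLp G 2 (volume.restrict K)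
  integral_eq : ∀ (k : Fin n) (φ : SpaceTime n → ℂ), IsTestFunction φ →
    ∫ z, u z * spaceDeriv k φ z = -∫ z, G z k * φ z

/-- `u`, with weak spatial gradient `G = ∇u`, lies in `L²_{loc,t}(H¹_{loc,x})` and solves
`u_t - div (A ∇u) = 0` on `ℝⁿ⁺¹` in the sense of distributions. -/
structure IsSolution {n : ℕ} (A : SpaceTime n → Matrix (Fin n) (Fin n) ℂ)
    (u : SpaceTime n → ℂ) (G : SpaceTime n → EuclideanSpace ℂ (Fin n)) : Prop where
  weakGradient : HasWeakSpatialGradient u G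
  equation : ∀ φ : SpaceTime n → ℂ, IsTestFunction φ →
    ∫ z, (-(u z * timeDeriv φ z) + ∑ k, ∑ l, A z k l * G z l * spaceDeriv k φ z) = 0

/-- `t ↦ u(·, t)` is continuous on the set of times `I` with values in `L²_loc(ℝⁿ)`. Every solution
has such a representative; fixing it gives the time slices `u(·, t)` a meaning for every `t`. -/
def ContinuousInL2Loc {n : ℕ} (u : SpaceTime n → ℂ) (I : Set ℝ) : Prop :=
  ∀ R : ℝ, ∀ t ∈ I,
    MemLp (fun x : Space n => u (x, t)) 2 (volume.restrict (Metric.ball 0 R)) ∧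
    Tendsto (fun s => eLpNorm (fun x : Space n => u (x, s) - u (x, t)) 2
      (volume.restrict (Metric.ball 0 R))) (𝓝[I] t) (𝓝 0)

/-!
The solution is radial and self-similar. With `N = ‖x‖ ^ 2 + |t|` and `q = |t| / N`, put
`V = N ^ (-α) Γ(q) x / n`, `u = div V` and `F = V_t`. Then `u_t = div F` holds whatever the profile
`Γ` is. By radial symmetry both `F` and `∇ u` are complex multiples of the real vector `x`, so
`F = a ∇ u` with a complex scalar `a`. The coefficients `A = a I` are bounded and elliptic as soon
as the flux and gradient profiles are bounded and the real part of one times the conjugate of the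
other is positive on `[0, 1]` (`exists_ellipticity`).

For `t ≥ 0` a constant profile does this (`const_profile_coercive`). For `t < 0` it takes a
spiralling profile `Γ = exp Θ` with `Θ' = r + i w` (`exists_profile`): the positivity becomes an
inequality between `r`, `w` and `q` (`spiral_inequality`). A real profile (`w = 0`) would contradict
the regularity theory of real equations. What a fast rotation `w` adds to the inequality has, where
it is needed, a coefficient comparable to `ε = n / 2 - 2 * α`; hence every exponent `α < n / 4` is
possible, at the price of ellipticity constants depending on `ε`. At time `0` the solution is a
multiple of `|x| ^ (-2 * α)`. For `α` close to `n / 4` this is locally in `L ^ 2` but not in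
`L ^ (2 + δ)`, and the blow-up of both norms follows from the scaling on balls of radius `√t`.

The equation in the sense of distributions comes from integrating by parts in `x` on time slices and
in `t` on the lines `{x} × ℝ`, both avoiding the origin. It needs that `V` is continuous across
`t = 0` and that all functions involved are locally integrable, which is
`locallyIntegrable_parabolicSq_rpow`.
-/

/-! ### The inequality for a spiralling profile -/

/-- Where `|Γ|` increases with `q` (`r ≥ 0`), the second factor of the amplitude term is negative,
so that this term is positive once `(1 - q) * r > α`. -/
theorem amplitude_term_le_of_nonneg {α ε B C q s r r' : ℝ} (hα : 0 < α) (hε : 0 < ε) (hB0 : 0 < B)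
    (hB1 : B ≤ 1)
    (hB2 : B ≤ α * (α + ε)) (hC : 0 < C) (hq0 : 0 ≤ q) (hq1 : q ≤ 1) (hs0 : 0 ≤ s)
    (hqr : q * r ≤ B * (s * (1 - s)))
    (hqr' : q ^ 2 * r' = -(2 * B * s * (1 - s) ^ 2) - C * q ^ 2) (hr : 0 ≤ r) :
    (1 - q) * q * (r + q * r' + q * r ^ 2) - (ε + q * (2 * α + 1)) * q * r
      - α * (α + ε + q * (α + 1)) ≤ -(α * (α + ε) / 2) := by
  have hss : s * (1 - s) ≤ 1 / 4 := by nlinarith [sq_nonneg (s - 1 / 2)]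
  have h1 : q * r ≤ B / 4 := hqr.trans (by nlinarith)
  have h0 : 0 ≤ q * r := by positivity
  have h2 : (q * r) ^ 2 ≤ B / 16 := by
    calc (q * r) ^ 2 ≤ (B / 4) ^ 2 := pow_le_pow_left₀ h0 h1 2
      _ ≤ B / 16 := by nlinarith
  have h3 : q ^ 2 * r' ≤ 0 := by
    rw [hqr']
    have : 0 ≤ 2 * B * s * (1 - s) ^ 2 := by positivity
    have : 0 ≤ C * q ^ 2 := by positivity
    linarith
  have h4 : (1 - q) * q * (r + q * r' + q * r ^ 2) ≤ B / 4 + B / 16 := by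
    have : q * (r + q * r' + q * r ^ 2) ≤ B / 4 + B / 16 := by nlinarith
    calc (1 - q) * q * (r + q * r' + q * r ^ 2) = (1 - q) *
      (q * (r + q * r' + q * r ^ 2)) := by ring
      _ ≤ (1 - q) * (B / 4 + B / 16) := mul_le_mul_of_nonneg_left this (by linarith)
      _ ≤ _ := by nlinarith
  have h5 : 0 ≤ (ε + q * (2 * α + 1)) * q * r := by positivity
  have h6 : 0 ≤ α * (q * (α + 1)) := by positivity
  nlinarith

/-- A lower bound for the second factor of the amplitude term that does not involve the width `b` of
the layer at `q = 0`. -/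
theorem le_amplitude_term {α ε B C q s r r' : ℝ} (hα : 0 < α) (hε : 0 < ε) (hB0 : 0 < B)
    (hB1 : B ≤ 1)
    (hC : 0 < C) (hq0 : 0 ≤ q) (hq1 : q ≤ 1) (hs0 : 0 ≤ s) (hs1 : s ≤ 1)
    (hqr : q * r ≤ B * (s * (1 - s))) (hrC : -(C * q) ≤ r)
    (hqr' : q ^ 2 * r' = -(2 * B * s * (1 - s) ^ 2) - C * q ^ 2) :
    -(2 * C + 2 + (ε + 2 * α + 1) + α * (2 * α + ε + 1)) ≤
    (1 - q) * q * (r + q * r' + q * r ^ 2) - (ε + q * (2 * α + 1)) * q * r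
      - α * (α + ε + q * (α + 1)) := by
  have hss : s * (1 - s) ≤ 1 / 4 := by nlinarith [sq_nonneg (s - 1 / 2)]
  have hss0 : 0 ≤ s * (1 - s) := mul_nonneg hs0 (by linarith)
  have h1 : q * r ≤ 1 := hqr.trans (by nlinarith)
  have hqq : q ^ 2 ≤ 1 := by nlinarith
  have h0 : -C ≤ q * r := by nlinarith
  have h3 : -(2 + C) ≤ q ^ 2 * r' := by
    rw [hqr']
    have : B * (s * (1 - s)) * (1 - s) ≤ 1 * 1 := by
      apply mul_le_mul _ (by linarith) (by linarith) one_pos.le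
      nlinarith
    nlinarith
  have h4 : -(2 + 2 * C) ≤ (1 - q) * q * (r + q * r' + q * r ^ 2) := by
    have h5 : -(2 + 2 * C) ≤ q * (r + q * r' + q * r ^ 2) := by nlinarith [sq_nonneg (q * r)]
    calc -(2 + 2 * C) ≤ (1 - q) * -(2 + 2 * C) := by nlinarith
      _ ≤ (1 - q) * (q * (r + q * r' + q * r ^ 2)) := mul_le_mul_of_nonneg_left h5 (by linarith)
      _ = _ := by ring
  have h6 : (ε + q * (2 * α + 1)) * (q * r) ≤ ε + 2 * α + 1 := by
    have : 0 ≤ ε + q * (2 * α + 1) := by positivity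
    have : ε + q * (2 * α + 1) ≤ ε + 2 * α + 1 := by nlinarith
    nlinarith
  have h7 : α * (α + ε + q * (α + 1)) ≤ α * (2 * α + ε + 1) :=
    mul_le_mul_of_nonneg_left (by nlinarith) hα.le
  nlinarith

/-- Outside a layer `s = b / (q + b) ≤ ε / 4`, the coefficient of the squared rotation speed is at
least `ε / 4`: it is here that `ε > 0`, that is `α < n / 4`, makes the rotation useful. -/
theorem le_phase_coefficient {α ε B q s r : ℝ} (hα : 0 < α) (hε : 0 < ε) (hB0 : 0 < B)
    (hB1 : B ≤ 1) (hq0 : 0 ≤ q) (hq1 : q ≤ 1) (hs0 : 0 ≤ s) (hs : s ≤ ε / 4)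
    (hqr : q * r ≤ B * (s * (1 - s))) :
    ε / 4 ≤ ε - 1 + (1 - ε / 4) * (1 - q) * (1 - s) + q * (α + 2) - (1 - q) * q * r := by
  have h0 : s * (1 - s) ≤ s := by nlinarith
  have h1 : q * r ≤ ε / 4 := by
    rcases le_or_gt s 1 with h | h
    · exact hqr.trans (by nlinarith [mul_nonneg hs0 (show 0 ≤ 1 - s by linarith)])
    · exact hqr.trans (by nlinarith [mul_nonneg hs0 (show 0 ≤ s - 1 by linarith)])
  have h2 : (1 - q) * (q * r) ≤ ε / 4 := by nlinarith
  have h3 : (1 - ε / 4) * (1 - s) ≥ 1 - ε / 2 := by nlinarith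
  have h4 : (1 - q) * ((1 - ε / 4) * (1 - s)) ≥ (1 - q) * (1 - ε / 2) :=
    mul_le_mul_of_nonneg_left h3 (by linarith)
  nlinarith [mul_nonneg hq0 hα.le, mul_nonneg hq0 hε.le]

/-- Near `q = 1` (the spatial origin) the rotation does not contribute, and the amplitude term is
positive by itself since `r` is close to `-C < -α` there. -/
theorem spiral_near_one {α ε C h b q r r1 r' : ℝ} (hα : 0 < α) (hε : 0 < ε)
    (hC : C = α + 2) (hh0 : 0 < h) (hh : h * (α + 2) = 1 / 12) (hb0 : 0 < b) (hb : b ≤ 1 / 4)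
    (hq0 : 1 - h ≤ q) (hq1 : q ≤ 1)
    (hr : r = r1 - C * q) (hr1 : r1 ≤ 4 * b) (hr1' : 0 ≤ r1) (hqr' : -(2 + C) ≤ q ^ 2 * r') :
    0 < (α - (1 - q) * r) * ((1 - q) * q * (r + q * r' + q * r ^ 2)
          - (ε + q * (2 * α + 1)) * q * r - α * (α + ε + q * (α + 1))) := by
  have hh1 : h ≤ 1 / 24 := by nlinarith
  have hq : 0 < q := by linarith
  have hr0 : r < 0 := by rw [hr, hC]; nlinarith
  have hA : 0 < α - (1 - q) * r := by nlinarith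
  refine mul_pos hA ?_
  have h1 : -(2 + 2 * C) ≤ q * (r + q * r' + q * r ^ 2) := by
    have : -C ≤ q * r := by rw [hr]; subst hC; nlinarith
    nlinarith [sq_nonneg (q * r)]
  have h2 : -(1 / 2) < (1 - q) * q * (r + q * r' + q * r ^ 2) := by
    have : -(2 + 2 * C) * (1 - q) ≤ (1 - q) * (q * (r + q * r' + q * r ^ 2)) := by nlinarith
    have : (2 + 2 * C) * (1 - q) ≤ (2 + 2 * C) * h := by
      apply mul_le_mul_of_nonneg_left; linarith; rw [hC]; positivity
    have : (2 + 2 * C) * h < 1 / 2 := by rw [hC]; nlinarith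
    nlinarith
  -- the main term
  have h3 : α + 1 / 2 ≤ -(q ^ 2 * r) := by
    have e1 : -(q ^ 2 * r) = C * q ^ 3 - q ^ 2 * r1 := by rw [hr]; ring
    have e2 : q ^ 2 * r1 ≤ 1 := by nlinarith
    have e3 : 1 - 3 * h ≤ q ^ 3 := by
      calc 1 - 3 * h ≤ (1 - h) ^ 3 := by nlinarith [pow_pos hh0 2]
        _ ≤ q ^ 3 := pow_le_pow_left₀ (by linarith) hq0 3
    have e4 : (α + 2) * (1 - 3 * h) ≤ (α + 2) * q ^ 3 :=
      mul_le_mul_of_nonneg_left e3 (by positivity)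
    rw [e1, hC]; nlinarith
  have h4 : (2 * α + ε + 1) * (α + 1 / 2) ≤ -((ε + q * (2 * α + 1)) * q * r) := by
    have e1 : q * (2 * α + ε + 1) ≤ ε + q * (2 * α + 1) := by nlinarith
    have e2 : q * (2 * α + ε + 1) * (q * -r) ≤ (ε + q * (2 * α + 1)) * (q * -r) :=
      mul_le_mul_of_nonneg_right e1 (by nlinarith)
    nlinarith [mul_le_mul_of_nonneg_left h3 (show 0 ≤ 2 * α + ε + 1 by positivity)]
  have h7 : α * (α + ε + q * (α + 1)) ≤ α * (2 * α + ε + 1) :=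
    mul_le_mul_of_nonneg_left (by nlinarith) hα.le
  nlinarith

/-- In the intermediate range the rotation term `Q` beats the amplitude term. -/
theorem spiral_middle {α C K0 Q q r S : ℝ} (hα : 0 < α) (hC : 0 < C) (hK : 0 < K0)
    (hq0 : 0 ≤ q) (hq1 : q ≤ 1) (hrC : -(C * q) ≤ r) (hSneg : 0 ≤ r → S ≤ 0) (hS : -K0 ≤ S)
    (hQ : (α + C) * K0 < Q) : 0 < (α - (1 - q) * r) * S + Q := by
  have hA : α - (1 - q) * r ≤ α + C := by
    have h1 : (1 - q) * -(C * q) ≤ (1 - q) * r := mul_le_mul_of_nonneg_left hrC (by linarith)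
    have h2 : (1 - q) * q ≤ 1 := by nlinarith
    nlinarith
  have hKC : 0 < (α + C) * K0 := by positivity
  rcases le_or_gt 0 S with h | h
  · rcases le_or_gt 0 (α - (1 - q) * r) with h' | h'
    · nlinarith [mul_nonneg h' h]
    · have : 0 ≤ r := by nlinarith
      have : S = 0 := le_antisymm (hSneg this) h
      rw [this]; nlinarith
  · rcases le_or_gt 0 (α - (1 - q) * r) with h' | h'
    · have : (α - (1 - q) * r) * -S ≤ (α + C) * K0 :=
        mul_le_mul hA (by linarith) (by linarith) (by positivity)
      linarith
    · nlinarith [mul_pos_of_neg_of_neg h' h]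

theorem mul_mul_one_sub_le_one {B s : ℝ} (hB1 : B ≤ 1) (hs0 : 0 ≤ s) (hs1 : s ≤ 1) :
    B * (s * (1 - s)) ≤ 1 :=
  mul_le_one₀ hB1 (mul_nonneg hs0 (by linarith)) (mul_le_one₀ hs1 (by linarith) (by linarith))

/-- Since the rotation speed is `V (q + b) ^ (κ - 1)`, its square decays no faster than `1 / q`. -/
theorem spiral_weight {b ε V q w2 : ℝ} (hε : 0 < ε) (hε1 : ε ≤ 1) (hqb : 0 < q + b) (hbq : b ≤ q)
    (hqb2 : q + b ≤ 2)
    (hw2' : w2 = V ^ 2 * ((q + b) ^ (ε / 2) / (q + b) ^ 2)) : V ^ 2 / 4 ≤ q * w2 := by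
  have e : q + b ≤ (q + b) ^ (ε / 2) * 2 := by
    rcases le_or_gt (q + b) 1 with h1 | h1
    · have : (q + b) ^ (1 : ℝ) ≤ (q + b) ^ (ε / 2) :=
        Real.rpow_le_rpow_of_exponent_ge hqb h1 (by linarith)
      rw [Real.rpow_one] at this
      linarith
    · have := Real.one_le_rpow h1.le (show 0 ≤ ε / 2 by positivity)
      linarith
  have e' : 1 / 4 ≤ q * ((q + b) ^ (ε / 2) / (q + b) ^ 2) := by
    rw [mul_div_assoc', le_div_iff₀ (by positivity)]
    have : (q + b) * (q + b) ≤ (2 * q) * ((q + b) ^ (ε / 2) * 2) :=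
      mul_le_mul (by linarith) e hqb.le (by linarith)
    linarith
  rw [hw2']
  linarith [mul_le_mul_of_nonneg_left e' (sq_nonneg V)]

/-- In the layer `q ≲ b` (late times) `r` is of size `1 / b`, and the amplitude term, also of size
`1 / b`, dominates the rotation term, which is of size `b ^ (ε / 2 - 1)`. -/
theorem spiral_near_zero {α ε B b C D V X q s r r1 S w2 Br : ℝ} (hα : 0 < α) (hε : 0 < ε)
    (hε1 : ε ≤ 1) (hB1 : B ≤ 1) (hC0 : 0 < C) (hX0 : 0 < X) (hD0 : 0 < D)
    (hb0 : 0 < b) (hb2 : X * b ≤ 1 / 2) (hb3 : C * X * b * b ≤ D / 2) (hb4 : 8 * α * b ≤ D)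
    (hb5 : 2 * X * V ^ 2 * b ^ (ε / 2) < D * (α * (α + ε)) / 16)
    (hq0 : 0 ≤ q) (hI : q ≤ X * b) (hs0 : 0 ≤ s) (hs2 : s ≤ 1) (hr : r = r1 - C * q)
    (h1 : D / b ≤ r1) (hqr : q * r ≤ B * (s * (1 - s)))
    (hSneg : 0 ≤ r → S ≤ -(α * (α + ε) / 2)) (hw20 : 0 ≤ w2)
    (hw2' : w2 = V ^ 2 * ((q + b) ^ (ε / 2) / (q + b) ^ 2))
    (hBr : Br = ε - 1 + (1 - ε / 4) * (1 - q) * (1 - s) + q * (α + 2) - (1 - q) * q * r) :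
    0 < (α - (1 - q) * r) * S + (1 - q) * q * w2 * Br := by
  have hq2 : q ≤ 1 / 2 := hI.trans hb2
  have hqb : 0 < q + b := by positivity
  have h2 : D / (2 * b) ≤ r := by
    have e : C * q ≤ D / (2 * b) := by
      rw [le_div_iff₀ (by positivity)]
      have : C * q ≤ C * (X * b) := mul_le_mul_of_nonneg_left hI hC0.le
      nlinarith
    have : D / b = D / (2 * b) + D / (2 * b) := by field_simp; norm_num
    rw [hr]; linarith
  have h3 : 4 * α ≤ D / (2 * b) := by rw [le_div_iff₀ (by positivity)]; linarith
  have hr0 : 0 < r := by linarith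
  have hA : α - (1 - q) * r ≤ -(r / 4) := by nlinarith
  have hS' := hSneg hr0.le
  have hαε : 0 < α * (α + ε) := by positivity
  have hAS : D / (2 * b) / 4 * (α * (α + ε) / 2) ≤ (α - (1 - q) * r) * S := by
    rw [← neg_mul_neg (α - (1 - q) * r)]
    exact mul_le_mul (by linarith) (by linarith) (by positivity) (by linarith)
  have hB2' : -2 ≤ Br := by
    have e1 : q * r ≤ 1 := hqr.trans (mul_mul_one_sub_le_one hB1 hs0 hs2)
    have e2 : (1 - q) * (q * r) ≤ 1 := by
      have : 0 ≤ q * r := by positivity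
      nlinarith
    have e3 : 0 ≤ (1 - ε / 4) * (1 - q) * (1 - s) :=
      mul_nonneg (mul_nonneg (by linarith) (by linarith)) (by linarith)
    rw [hBr]; linarith [mul_nonneg hq0 (show 0 ≤ α + 2 by linarith)]
  have hw : q * w2 ≤ X * V ^ 2 * b ^ (ε / 2) / b := by
    have e1 : (q + b) ^ (ε / 2) / (q + b) ^ 2 ≤ b ^ (ε / 2) / b ^ 2 := by
      rw [← Real.rpow_natCast, ← Real.rpow_natCast, ← Real.rpow_sub hqb, ← Real.rpow_sub hb0]
      exact Real.rpow_le_rpow_of_nonpos hb0 (by linarith) (by push_cast; linarith)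
    calc q * w2 ≤ (X * b) * (V ^ 2 * (b ^ (ε / 2) / b ^ 2)) := by
          rw [hw2']; gcongr
      _ = _ := by field_simp
  have hw' : (1 - q) * q * w2 * Br ≥ -(2 * (X * V ^ 2 * b ^ (ε / 2) / b)) := by
    have e0 : 0 ≤ q * w2 := by positivity
    have e1 : (1 - q) * (q * w2) ≤ X * V ^ 2 * b ^ (ε / 2) / b :=
      (mul_le_of_le_one_left e0 (by linarith)).trans hw
    have e2 : 0 ≤ (1 - q) * (q * w2) := mul_nonneg (by linarith) e0
    have e3 := mul_le_mul_of_nonneg_left hB2' e2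
    linarith
  have hfin : 2 * (X * V ^ 2 * b ^ (ε / 2) / b) < D / (2 * b) / 4 * (α * (α + ε) / 2) := by
    have : 2 * (X * V ^ 2 * b ^ (ε / 2) / b) = (2 * X * V ^ 2 * b ^ (ε / 2)) / b := by ring
    rw [this]
    have : D / (2 * b) / 4 * (α * (α + ε) / 2) = (D * (α * (α + ε)) / 16) / b := by
      field_simp; norm_num
    rw [this]
    gcongr
  linarith

set_option maxHeartbeats 1000000 in
/-- The inequality that makes the backward self-similar solution possible. The logarithmic
derivative of the profile is `r + i w` with `r = B b / (q + b) ^ 2 - C q` and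
`w = V (q + b) ^ (κ - 1)`, and the left side is, up to a positive factor, the real part of
`(flux) * conj (gradient)`. The first summand (the amplitude term) involves `r` only; the second is
the contribution of the rotation. The amplitude term forces `r > α` at `q = 0` and `r < -α` at
`q = 1`, and may be negative in between, where a fast rotation (`V` large) compensates for it. The
width `b` is chosen last. -/
theorem spiral_inequality {α ε : ℝ} (hα : 0 < α) (hε : 0 < ε) (hε1 : ε ≤ 1) :
    ∃ B b C V κ : ℝ, 0 < b ∧ 0 < κ ∧ ∀ q ∈ Icc (0 : ℝ) 1, ∀ r r' : ℝ,
      r = B * b / (q + b) ^ 2 - C * q → r' = -(2 * B * b) / (q + b) ^ 3 - C →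
      0 < (α - (1 - q) * r) * ((1 - q) * q * (r + q * r' + q * r ^ 2)
          - (ε + q * (2 * α + 1)) * q * r - α * (α + ε + q * (α + 1)))
        + (1 - q) * q * (V * (q + b) ^ (κ - 1)) ^ 2
          * (ε - 1 + (1 - κ) * (1 - q) * (q / (q + b)) + q * (α + 2) - (1 - q) * q * r) := by
  obtain ⟨B, hB0, hB1, hB2⟩ : ∃ B : ℝ, 0 < B ∧ B ≤ 1 ∧ B ≤ α * (α + ε) :=
    ⟨min 1 (α * (α + ε)), lt_min one_pos (by positivity), min_le_left _ _, min_le_right _ _⟩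
  obtain ⟨C, hC⟩ : ∃ C, C = α + 2 := ⟨_, rfl⟩
  have hC0 : 0 < C := by linarith
  obtain ⟨X, hX⟩ : ∃ X, X = 4 / ε := ⟨_, rfl⟩
  have hX0 : 0 < X := by rw [hX]; positivity
  have hX1 : 1 ≤ X := by rw [hX, le_div_iff₀ hε]; linarith
  obtain ⟨h, hh0, hh⟩ : ∃ h : ℝ, 0 < h ∧ h * (α + 2) = 1 / 12 :=
    ⟨1 / (12 * (α + 2)), by positivity, by field_simp⟩
  obtain ⟨K, hK⟩ : ∃ K, K = 2 * C + 2 + (ε + 2 * α + 1) + α * (2 * α + ε + 1) := ⟨_, rfl⟩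
  have hK0 : 0 < K := by rw [hK]; positivity
  obtain ⟨V, hV⟩ : ∃ V : ℝ, (α + C) * K < h * (ε / 4) * V ^ 2 / 4 := by
    have : Tendsto (fun V : ℝ => h * ε / 16 * V ^ 2) atTop atTop :=
      (tendsto_pow_atTop (by norm_num)).const_mul_atTop (by positivity)
    obtain ⟨V, hV⟩ := (this.eventually_gt_atTop ((α + C) * K)).exists
    exact ⟨V, by linarith⟩
  obtain ⟨D, hD⟩ : ∃ D, D = B / (1 + X) ^ 2 := ⟨_, rfl⟩
  have hD0 : 0 < D := by rw [hD]; positivity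
  obtain ⟨b, hb0, hb1, hb2, hb3, hb4, hb5⟩ : ∃ b : ℝ, 0 < b ∧ b ≤ 1 / 4 ∧ X * b ≤ 1 / 2 ∧
      C * X * b * b ≤ D / 2 ∧ 8 * α * b ≤ D ∧
      2 * X * V ^ 2 * b ^ (ε / 2) < D * (α * (α + ε)) / 16 := by
    have e0 : Tendsto (fun b : ℝ => b) (𝓝[>] 0) (𝓝 0) := tendsto_id.mono_left nhdsWithin_le_nhds
    have e1 : ∀ᶠ b : ℝ in 𝓝[>] 0, 0 < b := self_mem_nhdsWithin
    have e2 : ∀ᶠ b : ℝ in 𝓝[>] 0, b < 1 / 4 := e0.eventually_lt_const (by norm_num)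
    have e3 : ∀ᶠ b : ℝ in 𝓝[>] 0, X * b < 1 / 2 :=
      (by simpa using e0.const_mul X : Tendsto (fun b : ℝ => X * b) (𝓝[>] 0)
        (𝓝 0)).eventually_lt_const (by norm_num)
    have e4 : ∀ᶠ b : ℝ in 𝓝[>] 0, C * X * b * b < D / 2 :=
      (by simpa using (e0.const_mul (C * X)).mul e0 :
        Tendsto (fun b : ℝ => C * X * b * b) (𝓝[>] 0) (𝓝 0)).eventually_lt_const (by positivity)
    have e5 : ∀ᶠ b : ℝ in 𝓝[>] 0, 8 * α * b < D :=
      (by simpa using e0.const_mul (8 * α) :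
        Tendsto (fun b : ℝ => 8 * α * b) (𝓝[>] 0) (𝓝 0)).eventually_lt_const hD0
    have e6 : Tendsto (fun b : ℝ => b ^ (ε / 2)) (𝓝[>] 0) (𝓝 0) := by
      have := (Real.continuousAt_rpow_const 0 (ε / 2) (Or.inr (by positivity))).tendsto
      rw [Real.zero_rpow (by positivity)] at this
      exact this.mono_left nhdsWithin_le_nhds
    have e7 : ∀ᶠ b : ℝ in 𝓝[>] 0, 2 * X * V ^ 2 * b ^ (ε / 2) < D * (α * (α + ε)) / 16 :=
      (by simpa using e6.const_mul (2 * X * V ^ 2) :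
        Tendsto (fun b : ℝ => 2 * X * V ^ 2 * b ^ (ε / 2)) (𝓝[>] 0) (𝓝 0)).eventually_lt_const
        (by positivity)
    obtain ⟨b, h1, h2, h3, h4, h5, h7⟩ := (e1.and (e2.and (e3.and (e4.and (e5.and e7))))).exists
    exact ⟨b, h1, h2.le, h3.le, h4.le, h5.le, h7⟩
  -- The rotation speed decays like `q ^ (κ - 1)`; any `κ < ε` would do.
  refine ⟨B, b, C, V, ε / 4, hb0, by positivity, ?_⟩
  rintro q ⟨hq0, hq1⟩ r r' hr hr'
  have hqb : 0 < q + b := by positivity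
  obtain ⟨w2, hw2⟩ : ∃ w2, w2 = (V * (q + b) ^ (ε / 4 - 1)) ^ 2 := ⟨_, rfl⟩
  have hw20 : 0 ≤ w2 := by rw [hw2]; positivity
  have hw2' : w2 = V ^ 2 * ((q + b) ^ (ε / 2) / (q + b) ^ 2) := by
    rw [hw2, mul_pow, ← Real.rpow_mul_natCast hqb.le, ← Real.rpow_natCast (q + b) 2,
      ← Real.rpow_sub hqb]
    congr 2; push_cast; ring
  rw [← hw2]
  obtain ⟨s, hs⟩ : ∃ s, s = b / (q + b) := ⟨_, rfl⟩
  have hs0 : 0 < s := by rw [hs]; positivity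
  have hs1 : q / (q + b) = 1 - s := by rw [hs]; field_simp; ring
  have hs2 : s ≤ 1 := by rw [hs, div_le_one hqb]; linarith
  rw [hs1]
  obtain ⟨r1, hr1⟩ : ∃ r1, r1 = B * b / (q + b) ^ 2 := ⟨_, rfl⟩
  rw [← hr1] at hr
  have hr10 : 0 < r1 := by rw [hr1]; positivity
  have hqr1 : q * r1 = B * (s * (1 - s)) := by rw [hr1, ← hs1, hs]; field_simp
  have hq2r' : q ^ 2 * r' = -(2 * B * s * (1 - s) ^ 2) - C * q ^ 2 := by
    rw [hr', ← hs1, hs]; field_simp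
  have hqr : q * r ≤ B * (s * (1 - s)) := by
    rw [← hqr1, hr]; linarith [mul_nonneg hC0.le (mul_nonneg hq0 hq0)]
  have hrC : -(C * q) ≤ r := by rw [hr]; linarith
  have hSneg := amplitude_term_le_of_nonneg hα hε hB0 hB1 hB2 hC0 hq0 hq1 hs0.le hqr hq2r'
  have hSlow := le_amplitude_term hα hε hB0 hB1 hC0 hq0 hq1 hs0.le hs2 hqr hrC hq2r'
  rw [← hK] at hSlow
  obtain ⟨S, hS⟩ : ∃ S, S = (1 - q) * q * (r + q * r' + q * r ^ 2)
    - (ε + q * (2 * α + 1)) * q * r - α * (α + ε + q * (α + 1)) := ⟨_, rfl⟩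
  obtain ⟨Br, hBr⟩ : ∃ Br, Br = ε - 1 + (1 - ε / 4) * (1 - q) * (1 - s) + q * (α + 2)
    - (1 - q) * q * r := ⟨_, rfl⟩
  rcases le_or_gt q (X * b) with hI | hII
  · rw [← hS] at hSneg ⊢
    rw [← hBr]
    have h1 : D / b ≤ r1 := by
      rw [hD, hr1, div_div, div_le_div_iff₀ (by positivity) (by positivity)]
      have : (q + b) ^ 2 ≤ ((1 + X) * b) ^ 2 := pow_le_pow_left₀ hqb.le (by linarith) 2
      linarith [mul_le_mul_of_nonneg_left this hB0.le]
    exact spiral_near_zero hα hε hε1 hB1 hC0 hX0 hD0 hb0 hb2 hb3 hb4 hb5 hq0 hI hs0.le hs2 hr h1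
      hqr hSneg hw20 hw2' hBr
  have hqpos : 0 < q := lt_trans (by positivity) hII
  have hsX : s ≤ ε / 4 := by
    rw [hs, div_le_iff₀ hqb]
    have : X * b * ε = 4 * b := by rw [hX]; field_simp
    linarith [mul_lt_mul_of_pos_right hII hε, mul_pos hε hb0]
  have hBrpos := le_phase_coefficient hα hε hB0 hB1 hq0 hq1 hs0.le hsX hqr
  rcases le_or_gt (1 - h) q with hIII | hIV
  · have h24 : h ≤ 1 / 24 := by linarith [mul_pos hh0 hα]
    have hr4 : r1 ≤ 4 * b := by
      rw [hr1, div_le_iff₀ (by positivity)]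
      have e1 : (1 / 2) ^ 2 ≤ (q + b) ^ 2 := pow_le_pow_left₀ (by norm_num) (by linarith) 2
      have e2 : B * b ≤ b := mul_le_of_le_one_left hb0.le hB1
      have e3 := mul_le_mul_of_nonneg_left e1 hb0.le
      linarith
    have hr'' : -(2 + C) ≤ q ^ 2 * r' := by
      rw [hq2r']
      have e1 : B * (s * (1 - s)) * (1 - s) ≤ 1 * 1 := by
        apply mul_le_mul _ (by linarith) (by linarith) one_pos.le
        exact mul_mul_one_sub_le_one hB1 hs0.le hs2
      have e2 : C * q ^ 2 ≤ C * 1 := mul_le_mul_of_nonneg_left (pow_le_one₀ hq0 hq1) hC0.le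
      linarith
    refine add_pos_of_pos_of_nonneg
      (spiral_near_one hα hε hC hh0 hh hb0 hb1 hIII hq1 hr hr4 hr10.le hr'') ?_
    exact mul_nonneg (mul_nonneg (mul_nonneg (by linarith) hq0) hw20) (by linarith)
  · rw [← hS] at hSneg hSlow ⊢
    rw [← hBr] at hBrpos ⊢
    refine spiral_middle hα hC0 hK0 hq0 hq1 hrC
      (fun h => (hSneg h).trans (by have := mul_pos hα (add_pos hα hε); linarith)) hSlow ?_
    refine hV.trans_le ?_
    have hbq : b ≤ q := (le_mul_of_one_le_left hb0.le hX1).trans hII.le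
    have e1 := spiral_weight hε hε1 hqb hbq (by linarith) hw2'
    have e2 : h * (V ^ 2 / 4) ≤ (1 - q) * (q * w2) :=
      mul_le_mul (by linarith) e1 (by positivity) (by linarith)
    have e3 : h * (V ^ 2 / 4) * (ε / 4) ≤ (1 - q) * (q * w2) * Br :=
      mul_le_mul e2 hBrpos (by positivity) (le_trans (by positivity) e2)
    linarith

/-! ### Profiles -/

/-- `Γ` is the profile of a potential and `U` that of its divergence: with `N = ‖x‖ ^ 2 + |t|` and
`q = |t| / N`, the field `V = N ^ (-α) Γ(q) x / n` has divergence `N ^ (-α) U(q)`. The derivatives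
`Γ'` and `U'` are recorded on `[0, 1]`, the range of `q`. -/
structure IsProfile (n : ℕ) (α : ℝ) (Γ Γ' U U' : ℝ → ℂ) : Prop where
  hasDerivAt : ∀ q ∈ Icc (0 : ℝ) 1, HasDerivAt Γ (Γ' q) q
  hasDerivAt_U : ∀ q ∈ Icc (0 : ℝ) 1, HasDerivAt U (U' q) q
  eq : ∀ q, U q = Γ q - 2 / n * (1 - q) * (α * Γ q + q * Γ' q)
  continuousAt_deriv : ∀ q ∈ Icc (0 : ℝ) 1, ContinuousAt Γ' q
  continuousAt_derivU : ∀ q ∈ Icc (0 : ℝ) 1, ContinuousAt U' q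
  measurable : Measurable Γ
  measurable_deriv : Measurable Γ'
  measurable_U : Measurable U
  measurable_derivU : Measurable U'

/-- Forward in time the potential has a constant profile. -/
theorem isProfile_const (n : ℕ) (α : ℝ) (c : ℂ) :
    IsProfile n α (fun _ => c) (fun _ => 0) (fun q => c - 2 / n * (1 - q) * (α * c))
      (fun _ => 2 / n * (α * c)) where
  hasDerivAt _ _ := hasDerivAt_const _ _
  hasDerivAt_U q _ := by
    have h : HasDerivAt (fun q : ℝ => (q : ℂ)) 1 q := Complex.ofRealCLM.hasDerivAt
    convert! ((((h.const_sub 1).const_mul (2 / (n : ℂ))).mul_const (α * c))).const_sub c using 1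
    ring
  eq q := by simp
  continuousAt_deriv _ _ := continuousAt_const
  continuousAt_derivU _ _ := continuousAt_const
  measurable := by fun_prop
  measurable_deriv := by fun_prop
  measurable_U := by fun_prop
  measurable_derivU := by fun_prop

/-- For the constant profile, flux and gradient point in the same direction. This needs only
`2 * α < n`. -/
theorem const_profile_coercive {n : ℕ} (hn : 0 < n) {α : ℝ} (hα : 0 < α) (hαn : α < n / 4) {c : ℂ}
    (hc : c ≠ 0) {q : ℝ} (hq : q ∈ Icc (0 : ℝ) 1) :
    0 < (-(α * c) * (starRingEnd ℂ) (-(α * (c - 2 / n * (1 - q) * (α * c)) + q *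
      (2 / n * (α * c))))).re := by
  obtain ⟨hq0, hq1⟩ := hq
  have hn' : (0 : ℝ) < n := by exact_mod_cast hn
  have h : -(α * c) * (starRingEnd ℂ) (-(α * (c - 2 / n * (1 - q) * (α * c)) + q *
      (2 / n * (α * c))))
      = ((α ^ 2 * Complex.normSq c * (1 - 2 / n * (1 - q) * α + q * (2 / n)) : ℝ) : ℂ) := by
    push_cast [← Complex.mul_conj]
    simp only [map_neg, map_add, map_sub, map_mul, map_div₀, Complex.conj_ofReal, map_one,
      map_natCast, map_ofNat]
    ring
  rw [h, Complex.ofReal_re]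
  have h1 : 0 < Complex.normSq c := Complex.normSq_pos.2 hc
  have h2 : 2 / n * (1 - q) * α < 1 := by
    rw [div_mul_eq_mul_div, div_mul_eq_mul_div, div_lt_one hn']
    nlinarith
  have h3 : 0 ≤ q * (2 / (n : ℝ)) := by positivity
  have h4 : 0 < 1 - 2 / n * (1 - q) * α + q * (2 / n) := by linarith
  positivity

/-- Backward in time the potential has a spiralling profile `Γ = exp Θ` with `Θ' = r + i w` as in
`spiral_inequality`, so that the coefficient of `conj (gradient)` has positive real part. -/
theorem exists_profile {n : ℕ} (hn : 0 < n) {α ε : ℝ} (hα : 0 < α) (hε : 0 < ε) (hε1 : ε ≤ 1)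
    (hαn : (n : ℝ) = 2 * (2 * α + ε)) :
    ∃ Γ Γ' U U' : ℝ → ℂ, IsProfile n α Γ Γ' U U' ∧ (∀ q, Γ q ≠ 0) ∧
      ∀ q ∈ Icc (0 : ℝ) 1,
        0 < ((α * Γ q - (1 - q) * Γ' q) * (starRingEnd ℂ) (-(α * U q + q * U' q))).re := by
  obtain ⟨B, b, C, V, κ, hb, hκ, H⟩ := spiral_inequality hα hε hε1
  have hn' : (n : ℂ) ≠ 0 := by exact_mod_cast hn.ne'
  let r : ℝ → ℝ := fun q => B * b / (q + b) ^ 2 - C * q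
  let r' : ℝ → ℝ := fun q => -(2 * B * b) / (q + b) ^ 3 - C
  let w : ℝ → ℝ := fun q => V * (q + b) ^ (κ - 1)
  let w' : ℝ → ℝ := fun q => (κ - 1) / (q + b) * w q
  let η : ℝ → ℂ := fun q => r q + w q * Complex.I
  let η' : ℝ → ℂ := fun q => r' q + w' q * Complex.I
  let Θ : ℝ → ℂ := fun q => ((-(B * b / (q + b)) - C * q ^ 2 / 2 : ℝ) : ℂ)
    + ((V / κ * (q + b) ^ κ : ℝ) : ℂ) * Complex.I
  let Γ : ℝ → ℂ := fun q => Complex.exp (Θ q)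
  let U : ℝ → ℂ := fun q => Γ q * (1 - 2 / n * (1 - q) * (α + q * η q))
  let U' : ℝ → ℂ := fun q => Γ q * η q * (1 - 2 / n * (1 - q) * (α + q * η q))
    + Γ q * (2 / n * (α + q * η q) - 2 / n * (1 - q) * (η q + q * η' q))
  have hqb : ∀ q ∈ Icc (0 : ℝ) 1, q + b ≠ 0 := fun q hq => by have := hq.1; positivity
  have hadd : ∀ q : ℝ, HasDerivAt (fun q : ℝ => q + b) 1 q := fun q => (hasDerivAt_id q).add_const b
  have hr : ∀ q ∈ Icc (0 : ℝ) 1, HasDerivAt r (r' q) q := by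
    intro q hq
    have h0 := hqb q hq
    have h1 := ((hasDerivAt_const q (B * b)).fun_div ((hadd q).fun_pow 2)
        (pow_ne_zero 2 h0)).fun_sub
      ((hasDerivAt_id q).const_mul C)
    convert! h1 using 1
    simp only [r']
    field_simp
    simp
    ring
  have hw : ∀ q ∈ Icc (0 : ℝ) 1, HasDerivAt w (w' q) q := by
    intro q hq
    have h0 := hqb q hq
    have h1 := ((hadd q).rpow_const (p := κ - 1) (Or.inl h0)).const_mul V
    convert! h1 using 1
    simp only [w', w]
    rw [Real.rpow_sub_one h0 (κ - 1)]
    field_simp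
  have hη : ∀ q ∈ Icc (0 : ℝ) 1, HasDerivAt η (η' q) q := fun q hq =>
    (hr q hq).ofReal_comp.add ((hw q hq).ofReal_comp.mul_const _)
  have hΘ : ∀ q ∈ Icc (0 : ℝ) 1, HasDerivAt Θ (η q) q := by
    intro q hq
    have h0 := hqb q hq
    have h1 := (((hasDerivAt_const q (B * b)).fun_div (hadd q) h0).fun_neg).fun_sub
      (((hasDerivAt_pow 2 q).const_mul C).div_const 2)
    have h2 := ((hadd q).rpow_const (p := κ) (Or.inl h0)).const_mul (V / κ)
    refine HasDerivAt.congr_deriv (h1.ofReal_comp.add (h2.ofReal_comp.mul_const Complex.I)) ?_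
    simp only [η, r, w]
    congr 2
    · congr 1; field_simp; simp; ring
    · congr 1; field_simp
  have hΓ : ∀ q ∈ Icc (0 : ℝ) 1, HasDerivAt Γ (Γ q * η q) q := fun q hq => (hΘ q hq).cexp
  have hofReal : ∀ q : ℝ, HasDerivAt (fun q : ℝ => (q : ℂ)) 1 q := fun q =>
    Complex.ofRealCLM.hasDerivAt
  have hU : ∀ q ∈ Icc (0 : ℝ) 1, HasDerivAt U (U' q) q := by
    intro q hq
    refine HasDerivAt.congr_deriv ((hΓ q hq).mul (((((hofReal q).const_sub 1).const_mul
      (2 / (n : ℂ))).mul (((hofReal q).mul (hη q hq)).const_add (α : ℂ))).const_sub 1)) ?_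
    simp only [U', Pi.mul_apply]
    ring
  have cr' : ∀ q ∈ Icc (0 : ℝ) 1, ContinuousAt r' q := fun q hq =>
    (continuousAt_const.div (by fun_prop : ContinuousAt (fun q : ℝ => (q + b) ^ 3) q)
      (pow_ne_zero 3 (hqb q hq))).sub continuousAt_const
  have cw' : ∀ q ∈ Icc (0 : ℝ) 1, ContinuousAt w' q := fun q hq =>
    (continuousAt_const.div (by fun_prop : ContinuousAt (fun q : ℝ => q + b) q) (hqb q hq)).mul
      (hw q hq).continuousAt
  have cη' : ∀ q ∈ Icc (0 : ℝ) 1, ContinuousAt η' q := fun q hq =>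
    (Complex.continuous_ofReal.continuousAt.comp (cr' q hq)).add
      ((Complex.continuous_ofReal.continuousAt.comp (cw' q hq)).mul continuousAt_const)
  have mη : Measurable η := by fun_prop
  have mη' : Measurable η' := by fun_prop
  have mΓ : Measurable Γ := by fun_prop
  refine ⟨Γ, fun q => Γ q * η q, U, U', ⟨hΓ, hU, ?_, ?_, ?_, mΓ, by fun_prop, by fun_prop,
      by fun_prop⟩,
    fun q => Complex.exp_ne_zero _, ?_⟩
  · intro q
    simp only [U]; ring
  · exact fun q hq => (hΓ q hq).continuousAt.mul (hη q hq).continuousAt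
  · intro q hq
    have c1 := (hΓ q hq).continuousAt
    have c2 := (hη q hq).continuousAt
    have c3 := cη' q hq
    fun_prop
  · intro q hq
    have h := H q hq (r q) (r' q) rfl rfl
    have hT : -(α * U q + q * U' q) = Γ q * (2 / n * ((1 - q) * q * (η q + q * η' q + q * η q ^ 2)
        - (ε + q * (2 * α + 1)) * q * η q - α * (α + ε + q * (α + 1)))) := by
      have hε' : (ε : ℂ) = n / 2 - 2 * α := by
        rw [← Complex.ofReal_natCast, hαn]; push_cast; ring
      simp only [U, U']
      rw [hε']
      field_simp
      ring
    have key : (α * Γ q - (1 - q) * (Γ q * η q)) * (starRingEnd ℂ) (-(α * U q + q * U' q))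
        = ((2 / n * Complex.normSq (Γ q) : ℝ) : ℂ) * ((α - (1 - q) * η q) * (starRingEnd ℂ)
        ((1 - q) * q * (η q + q * η' q + q * η q ^ 2)
        - (ε + q * (2 * α + 1)) * q * η q - α * (α + ε + q * (α + 1)))) := by
      rw [hT, map_mul, map_mul]
      push_cast [← Complex.mul_conj]
      simp only [map_div₀, map_natCast, map_ofNat]
      ring
    rw [key, Complex.re_ofReal_mul]
    have hpos : 0 < 2 / n * Complex.normSq (Γ q) := by
      have : 0 < Complex.normSq (Γ q) := Complex.normSq_pos.2 (Complex.exp_ne_zero _)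
      have : (0 : ℝ) < n := by exact_mod_cast hn
      positivity
    refine mul_pos hpos ?_
    refine h.trans_eq ?_
    have hv : V * (q + b) ^ (κ - 1) = w q := rfl
    rw [hv]
    simp only [η, η', w']
    generalize w q = v
    generalize r q = R
    generalize r' q = R'
    simp only [Complex.mul_re, Complex.mul_im, Complex.add_re, Complex.add_im, Complex.sub_re,
      Complex.sub_im, Complex.ofReal_re, Complex.ofReal_im, Complex.I_re, Complex.I_im,
      Complex.conj_re, Complex.conj_im, Complex.one_re, Complex.one_im, pow_two, Complex.re_ofNat,
      Complex.im_ofNat]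
    ring

section

variable {n : ℕ}

/-! ### Self-similar functions -/

/-- The square `N = ‖x‖ ^ 2 + |t|` of the parabolic distance to the origin. -/
noncomputable def parabolicSq (z : SpaceTime n) : ℝ := ‖z.1‖ ^ 2 + |z.2|

/-- The self-similar variable `q = |t| / N`, which ranges over `[0, 1]`: it is `0` at
time `0` and `1` on the axis `x = 0`. -/
noncomputable def timeRatio (z : SpaceTime n) : ℝ := |z.2| / parabolicSq z

/-- The function `N ^ (-β) P(q)` for `t < 0` and `N ^ (-β) Q(q)` for `t ≥ 0`. -/
noncomputable def selfSimilar (β : ℝ) (P Q : ℝ → ℂ) (z : SpaceTime n) : ℂ :=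
  ((parabolicSq z ^ (-β) : ℝ) : ℂ) * if z.2 < 0 then P (timeRatio z) else Q (timeRatio z)

theorem parabolicSq_nonneg (z : SpaceTime n) : 0 ≤ parabolicSq z := by
  unfold parabolicSq; positivity

theorem parabolicSq_pos_of_snd {z : SpaceTime n} (hz : z.2 ≠ 0) : 0 < parabolicSq z := by
  unfold parabolicSq; positivity

theorem parabolicSq_pos_of_fst {z : SpaceTime n} (hz : z.1 ≠ 0) : 0 < parabolicSq z := by
  unfold parabolicSq; positivity

@[fun_prop]
theorem continuous_parabolicSq : Continuous (parabolicSq (n := n)) := by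
  unfold parabolicSq; fun_prop

theorem timeRatio_mem (z : SpaceTime n) : timeRatio z ∈ Icc (0 : ℝ) 1 :=
  ⟨div_nonneg (abs_nonneg _) (parabolicSq_nonneg z),
    div_le_one_of_le₀ (by unfold parabolicSq; nlinarith [sq_nonneg ‖z.1‖]) (parabolicSq_nonneg z)⟩

theorem measurable_timeRatio : Measurable (timeRatio (n := n)) :=
  (continuous_abs.comp continuous_snd).measurable.div continuous_parabolicSq.measurable

theorem norm_sq_eq {z : SpaceTime n} (hz : 0 < parabolicSq z) :
    ‖z.1‖ ^ 2 = parabolicSq z * (1 - timeRatio z) := by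
  unfold timeRatio
  field_simp
  simp [parabolicSq]

theorem measurable_ite_timeRatio {X : Type*} [MeasurableSpace X] {P Q : ℝ → X} (hP : Measurable P)
    (hQ : Measurable Q) :
    Measurable fun z : SpaceTime n => if z.2 < 0 then P (timeRatio z) else Q (timeRatio z) :=
  Measurable.ite (measurableSet_lt measurable_snd measurable_const)
    (hP.comp measurable_timeRatio) (hQ.comp measurable_timeRatio)

theorem measurable_selfSimilar {β : ℝ} {P Q : ℝ → ℂ} (hP : Measurable P) (hQ : Measurable Q) :
    Measurable (selfSimilar (n := n) β P Q) :=
  (Complex.measurable_ofReal.comp (continuous_parabolicSq.measurable.pow_const _)).mul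
    (measurable_ite_timeRatio hP hQ)

theorem norm_selfSimilar_le {β K : ℝ} {P Q : ℝ → ℂ} (hP : ∀ q ∈ Icc (0 : ℝ) 1, ‖P q‖ ≤ K)
    (hQ : ∀ q ∈ Icc (0 : ℝ) 1, ‖Q q‖ ≤ K) (z : SpaceTime n) :
    ‖selfSimilar β P Q z‖ ≤ K * parabolicSq z ^ (-β) := by
  have h := Real.rpow_nonneg (parabolicSq_nonneg z) (-β)
  rw [selfSimilar, norm_mul, Complex.norm_real, Real.norm_of_nonneg h, mul_comm]
  gcongr
  split_ifs
  exacts [hP _ (timeRatio_mem z), hQ _ (timeRatio_mem z)]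

theorem continuousAt_timeRatio {z : SpaceTime n} (hz : 0 < parabolicSq z) :
    ContinuousAt timeRatio z :=
  (continuous_abs.comp continuous_snd).continuousAt.div continuous_parabolicSq.continuousAt hz.ne'

theorem continuousAt_parabolicSq_rpow {β : ℝ} {z : SpaceTime n} (hz : 0 < parabolicSq z) :
    ContinuousAt (fun z => ((parabolicSq z ^ (-β) : ℝ) : ℂ)) z :=
  Complex.continuous_ofReal.continuousAt.comp
    (continuous_parabolicSq.continuousAt.rpow_const (Or.inl hz.ne'))

theorem continuousAt_selfSimilar {β : ℝ} {P Q : ℝ → ℂ}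
    (hP : ∀ q ∈ Icc (0 : ℝ) 1, ContinuousAt P q) (hQ : ∀ q ∈ Icc (0 : ℝ) 1, ContinuousAt Q q)
    {z : SpaceTime n} (hz : z.2 ≠ 0) : ContinuousAt (selfSimilar β P Q) z := by
  have hN := parabolicSq_pos_of_snd hz
  refine (continuousAt_parabolicSq_rpow hN).mul ?_
  rcases hz.lt_or_gt with h | h
  · refine ((hP _ (timeRatio_mem z)).comp (continuousAt_timeRatio hN)).congr ?_
    filter_upwards [(isOpen_lt continuous_snd continuous_const).mem_nhds h] with y hy
    exact (if_pos hy).symm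
  · refine ((hQ _ (timeRatio_mem z)).comp (continuousAt_timeRatio hN)).congr ?_
    filter_upwards [(isOpen_lt continuous_const continuous_snd).mem_nhds h] with y hy
    exact (if_neg (not_lt.2 (le_of_lt hy))).symm

/-- Matching the profiles at `q = 0` makes a self-similar function continuous across `t = 0`, away
from `x = 0`. -/
theorem continuousAt_selfSimilar_zero {β : ℝ} {P Q : ℝ → ℂ}
    (hP : ContinuousAt P 0) (hQ : ContinuousAt Q 0) (h0 : P 0 = Q 0)
    {x : Space n} (hx : x ≠ 0) : ContinuousAt (selfSimilar β P Q) (x, 0) := by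
  have hN : 0 < parabolicSq (x, (0 : ℝ)) := parabolicSq_pos_of_fst hx
  have hq : timeRatio (x, (0 : ℝ)) = 0 := by simp [timeRatio]
  refine (continuousAt_parabolicSq_rpow hN).mul ?_
  have hc := (continuousAt_timeRatio hN).tendsto
  rw [hq] at hc
  have h1 := hP.tendsto.comp hc
  have h2 := hQ.tendsto.comp hc
  rw [h0] at h1
  have := Tendsto.if' (p := fun z : SpaceTime n => z.2 < 0) h1 h2
  simpa [ContinuousAt, hq] using this

theorem hasDerivAt_rpow_mul_fst {α σ τ : ℝ} (h : 0 < σ + τ) {P : ℝ → ℂ} {P' : ℂ}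
    (hP : HasDerivAt P P' (τ / (σ + τ))) :
    HasDerivAt (fun σ => (((σ + τ) ^ (-α) : ℝ) : ℂ) * P (τ / (σ + τ)))
      ((((σ + τ) ^ (-(α + 1)) : ℝ) : ℂ)
        * -(α * P (τ / (σ + τ)) + (τ / (σ + τ) : ℝ) * P')) σ := by
  have h1 : HasDerivAt (fun σ => σ + τ) 1 σ := (hasDerivAt_id σ).add_const τ
  have h2 := (h1.rpow_const (p := -α) (Or.inl h.ne')).ofReal_comp
  have h3 : HasDerivAt (fun σ => τ / (σ + τ)) (-(τ / (σ + τ) / (σ + τ))) σ := by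
    convert! (hasDerivAt_const σ τ).fun_div h1 h.ne' using 1
    field_simp; simp
  have h4 := h2.mul (hP.scomp σ h3)
  convert! h4 using 1
  rw [show -α - 1 = -(α + 1) by ring]
  have e : (σ + τ) ^ (-α) = (σ + τ) ^ (-(α + 1)) * (σ + τ) := by
    rw [← Real.rpow_add_one h.ne']; ring_nf
  have h0 : (σ + τ : ℂ) ≠ 0 := by exact_mod_cast h.ne'
  simp only [Function.comp_apply, Complex.real_smul]
  rw [e]; push_cast; field_simp; ring

theorem hasDerivAt_rpow_mul_snd {α σ τ : ℝ} (h : 0 < σ + τ) {P : ℝ → ℂ} {P' : ℂ}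
    (hP : HasDerivAt P P' (τ / (σ + τ))) :
    HasDerivAt (fun τ => (((σ + τ) ^ (-α) : ℝ) : ℂ) * P (τ / (σ + τ)))
      ((((σ + τ) ^ (-(α + 1)) : ℝ) : ℂ)
        * (-(α * P (τ / (σ + τ))) + (1 - (τ / (σ + τ) : ℝ)) * P')) τ := by
  have h1 : HasDerivAt (fun τ => σ + τ) 1 τ := (hasDerivAt_id τ).const_add σ
  have h2 := (h1.rpow_const (p := -α) (Or.inl h.ne')).ofReal_comp
  have h3 : HasDerivAt (fun τ => τ / (σ + τ)) ((1 - τ / (σ + τ)) / (σ + τ)) τ := by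
    convert! (hasDerivAt_id τ).fun_div h1 h.ne' using 1
    field_simp; simp
  have h4 := h2.mul (hP.scomp τ h3)
  convert! h4 using 1
  rw [show -α - 1 = -(α + 1) by ring]
  have e : (σ + τ) ^ (-α) = (σ + τ) ^ (-(α + 1)) * (σ + τ) := by
    rw [← Real.rpow_add_one h.ne']; ring_nf
  have h0 : (σ + τ : ℂ) ≠ 0 := by exact_mod_cast h.ne'
  simp only [Function.comp_apply, Complex.real_smul]
  rw [e]; push_cast; field_simp

/-- The profile, with exponent `α + 1`, of the derivative of `N ^ (-α) P(q)` in `‖x‖ ^ 2`. -/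
noncomputable def radialProfile (α : ℝ) (P P' : ℝ → ℂ) (q : ℝ) : ℂ := -(α * P q + q * P' q)

/-- The profile, with exponent `α + 1`, of the time derivative of `N ^ (-α) P(q)` for `t < 0`. -/
noncomputable def backwardProfile (α : ℝ) (P P' : ℝ → ℂ) (q : ℝ) : ℂ := α * P q - (1 - q) * P' q

/-- The profile, with exponent `α + 1`, of the time derivative of `N ^ (-α) P(q)` for `t > 0`. -/
noncomputable def forwardProfile (α : ℝ) (P P' : ℝ → ℂ) (q : ℝ) : ℂ := -(α * P q) + (1 - q) * P' q

theorem hasFDerivAt_selfSimilar {α : ℝ} {P P' Q Q' : ℝ → ℂ}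
    (hP : ∀ q ∈ Icc (0 : ℝ) 1, HasDerivAt P (P' q) q)
    (hQ : ∀ q ∈ Icc (0 : ℝ) 1, HasDerivAt Q (Q' q) q) {t : ℝ} (ht : t ≠ 0) (x : Space n) :
    HasFDerivAt (fun y : Space n => selfSimilar α P Q (y, t))
      ((2 • innerSL ℝ x : Space n →L[ℝ] ℝ).smulRight
        (selfSimilar (α + 1) (radialProfile α P P') (radialProfile α Q Q') (x, t))) x := by
  have hN : 0 < ‖x‖ ^ 2 + |t| := parabolicSq_pos_of_snd (z := (x, t)) ht
  have hq := timeRatio_mem (x, t)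
  have h0 := (hasStrictFDerivAt_norm_sq x).hasFDerivAt
  rcases lt_or_ge t 0 with h | h
  · have h1 := (hasDerivAt_rpow_mul_fst (α := α) hN (hP _ hq)).hasFDerivAt.comp x h0
    simp only [selfSimilar, if_pos h]
    refine h1.congr_fderiv ?_
    ext v
    simp [timeRatio, parabolicSq, radialProfile]
    ring
  · have h1 := (hasDerivAt_rpow_mul_fst (α := α) hN (hQ _ hq)).hasFDerivAt.comp x h0
    simp only [selfSimilar, if_neg (not_lt.2 h)]
    refine h1.congr_fderiv ?_
    ext v
    simp [timeRatio, parabolicSq, radialProfile]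
    ring

theorem hasDerivAt_selfSimilar {α : ℝ} {P P' Q Q' : ℝ → ℂ}
    (hP : ∀ q ∈ Icc (0 : ℝ) 1, HasDerivAt P (P' q) q)
    (hQ : ∀ q ∈ Icc (0 : ℝ) 1, HasDerivAt Q (Q' q) q) {t : ℝ} (ht : t ≠ 0) (x : Space n) :
    HasDerivAt (fun s : ℝ => selfSimilar α P Q (x, s))
      (selfSimilar (α + 1) (backwardProfile α P P') (forwardProfile α Q Q') (x, t)) t := by
  have hN : 0 < ‖x‖ ^ 2 + |t| := parabolicSq_pos_of_snd (z := (x, t)) ht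
  have hq := timeRatio_mem (x, t)
  rcases ht.lt_or_gt with h | h
  · have h1 := HasDerivAt.scomp t (hasDerivAt_rpow_mul_snd (α := α) hN (hP _ hq))
      (hasDerivAt_abs_neg h)
    have h2 := h1.congr_of_eventuallyEq (f₁ := fun s : ℝ => selfSimilar α P Q (x, s)) (by
      filter_upwards [gt_mem_nhds h] with s hs
      simp [selfSimilar, hs, timeRatio, parabolicSq])
    refine h2.congr_deriv ?_
    simp only [selfSimilar, timeRatio, parabolicSq, if_pos h]
    simp [backwardProfile]
    ring
  · have h1 := HasDerivAt.scomp t (hasDerivAt_rpow_mul_snd (α := α) hN (hQ _ hq))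
      (hasDerivAt_abs_pos h)
    have h2 := h1.congr_of_eventuallyEq (f₁ := fun s : ℝ => selfSimilar α P Q (x, s)) (by
      filter_upwards [lt_mem_nhds h] with s hs
      simp [selfSimilar, not_lt.2 hs.le, timeRatio, parabolicSq])
    refine h2.congr_deriv ?_
    simp only [selfSimilar, timeRatio, parabolicSq, if_neg (not_lt.2 h.le)]
    simp [forwardProfile]

/-! ### Local integrability and integration by parts -/

theorem ae_fst_ne (hn : 0 < n) : ∀ᵐ z : SpaceTime n, z.1 ≠ 0 := by
  have : Nonempty (Fin n) := ⟨⟨0, hn⟩⟩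
  have h : ∀ᵐ x : Space n, x ≠ 0 := by
    simp [ae_iff]
  exact (Measure.quasiMeasurePreserving_fst (μ := (volume : Measure (Space n)))
    (ν := (volume : Measure ℝ))).ae h

theorem ae_snd_ne : ∀ᵐ z : SpaceTime n, z.2 ≠ 0 := by
  have h : ∀ᵐ t : ℝ, t ≠ 0 := by simp [ae_iff]
  exact (Measure.quasiMeasurePreserving_snd (μ := (volume : Measure (Space n)))
    (ν := (volume : Measure ℝ))).ae h

theorem locallyIntegrable_norm_rpow (hn : 0 < n) {a : ℝ} (ha : a < n) :
    LocallyIntegrable (fun x : Space n => ‖x‖ ^ (-a)) := by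
  have hd : Module.finrank ℝ (Space n) = n := by simp
  refine locallyIntegrable_of_norm_le_rpow (C := 1) (α := a) ?_ ?_ ?_ ?_
  · omega
  · rw [hd]; exact ha
  · filter_upwards with x
    rw [one_mul, Real.norm_of_nonneg (by positivity)]
  · exact (measurable_norm.pow_const _).aestronglyMeasurable

theorem locallyIntegrable_abs_rpow {a : ℝ} (ha : a < 1) :
    LocallyIntegrable (fun t : ℝ => |t| ^ (-a)) := by
  refine locallyIntegrable_of_norm_le_rpow (C := 1) (α := a) ?_ ?_ ?_ ?_
  · simp
  · simpa using ha
  · filter_upwards with x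
    rw [one_mul, Real.norm_of_nonneg (by positivity), Real.norm_eq_abs]
  · exact (measurable_norm.pow_const _).aestronglyMeasurable

/-- The parabolic dimension of space-time is `n + 2`: `N ^ (-s)` is locally integrable for
`s < n / 2 + 1`. It is bounded by a product `‖x‖ ^ (-2 a) * |t| ^ (-b)` with `a + b = s`,
`2 * a < n` and `b < 1`. -/
theorem locallyIntegrable_parabolicSq_rpow (hn : 0 < n) {s : ℝ} (hs0 : 0 < s) (hs : s < n / 2 + 1) :
    LocallyIntegrable (fun z : SpaceTime n => parabolicSq z ^ (-s)) := by
  obtain ⟨a, b, ha0, hb0, ha, hb, hab⟩ : ∃ a b : ℝ,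
      0 ≤ a ∧ 0 ≤ b ∧ 2 * a < n ∧ b < 1 ∧ a + b = s := by
    have hn' : (0 : ℝ) < n := by exact_mod_cast hn
    have hd : 0 < (n : ℝ) / 2 + 1 := by positivity
    refine ⟨s * (n / 2) / (n / 2 + 1), s / (n / 2 + 1), by positivity, by positivity, ?_, ?_, ?_⟩
    · rw [mul_div_assoc', div_lt_iff₀ hd]; nlinarith
    · rwa [div_lt_one hd]
    · field_simp
  rw [locallyIntegrable_iff]
  intro K hK
  have h1 : IntegrableOn (fun x : Space n => ‖x‖ ^ (-(2 * a))) (Prod.fst '' K) :=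
    (locallyIntegrable_norm_rpow hn ha).integrableOn_isCompact (hK.image continuous_fst)
  have h2 : IntegrableOn (fun t : ℝ => |t| ^ (-b)) (Prod.snd '' K) :=
    (locallyIntegrable_abs_rpow hb).integrableOn_isCompact (hK.image continuous_snd)
  have h3 : IntegrableOn (fun z : SpaceTime n => ‖z.1‖ ^ (-(2 * a)) * |z.2| ^ (-b))
      ((Prod.fst '' K) ×ˢ (Prod.snd '' K)) := by
    rw [IntegrableOn, Measure.volume_eq_prod, ← Measure.prod_restrict]
    exact Integrable.mul_prod h1 h2
  refine (h3.mono_set subset_prod).mono'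
    (continuous_parabolicSq.measurable.pow_const _).aestronglyMeasurable ?_
  filter_upwards [ae_restrict_of_ae (ae_fst_ne hn), ae_restrict_of_ae ae_snd_ne] with z h1 h2
  have hx : 0 < ‖z.1‖ := norm_pos_iff.2 h1
  have ht : 0 < |z.2| := abs_pos.2 h2
  have hN := parabolicSq_pos_of_snd h2
  rw [Real.norm_of_nonneg (Real.rpow_nonneg hN.le _), ← hab, neg_add, Real.rpow_add hN,
    neg_mul_eq_mul_neg, Real.rpow_mul hx.le, Real.rpow_two]
  refine mul_le_mul ?_ ?_ (Real.rpow_nonneg hN.le _) (Real.rpow_nonneg (by positivity) _)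
  · exact Real.rpow_le_rpow_of_nonpos (by positivity) (by simp [parabolicSq]) (by linarith)
  · exact Real.rpow_le_rpow_of_nonpos ht (by simp [parabolicSq]) (by linarith)

theorem memLp_two_of_le_parabolicSq_rpow {E : Type*} [NormedAddCommGroup E] (hn : 0 < n) {β γ C : ℝ}
    (hβ0 : 0 < β) (hβ : 4 * β < n + 2) (hγ : γ ≤ β) {f : SpaceTime n → E}
      (hf : AEStronglyMeasurable f)
    (hle : ∀ z : SpaceTime n, z.1 ≠ 0 → ‖f z‖ ≤ C * parabolicSq z ^ (-γ)) {K : Set (SpaceTime n)}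
      (hK : IsCompact K) :
    MemLp f 2 (volume.restrict K) := by
  obtain ⟨R, hR⟩ := hK.bddAbove_image continuous_parabolicSq.continuousOn
  have hint : IntegrableOn (fun z : SpaceTime n => (C * R ^ (β - γ)) ^ 2 * parabolicSq z ^
      (-(2 * β))) K :=
    ((locallyIntegrable_parabolicSq_rpow hn (by positivity) (by linarith)).integrableOn_isCompact
      hK).const_mul _
  rw [memLp_two_iff_integrable_sq_norm hf.restrict]
  refine Integrable.mono' hint (hf.restrict.norm.pow 2) ?_
  filter_upwards [ae_restrict_of_ae (ae_fst_ne hn),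
    ae_restrict_mem₀ hK.measurableSet.nullMeasurableSet] with z hz hzK
  have hN := parabolicSq_pos_of_fst hz
  have hNR : parabolicSq z ≤ R := hR (mem_image_of_mem _ hzK)
  have hC : 0 ≤ C := by
    by_contra! h
    have := (norm_nonneg _).trans (hle z hz)
    exact absurd this (not_le.2 (mul_neg_of_neg_of_pos h (Real.rpow_pos_of_pos hN _)))
  have h1 : ‖f z‖ ≤ C * R ^ (β - γ) * parabolicSq z ^ (-β) := by
    refine (hle z hz).trans ?_
    rw [show -γ = (β - γ) + -β by ring, Real.rpow_add hN, ← mul_assoc]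
    gcongr
  rw [Real.norm_of_nonneg (by positivity)]
  calc ‖f z‖ ^ 2 ≤ (C * R ^ (β - γ) * parabolicSq z ^ (-β)) ^ 2 := by gcongr
    _ = _ := by
      rw [mul_pow, ← Real.rpow_natCast (parabolicSq z ^ (-β)) 2, ← Real.rpow_mul hN.le]
      congr 2; push_cast; ring

theorem locallyIntegrable_of_memLp_two {E : Type*} [NormedAddCommGroup E] {f : SpaceTime n → E}
    (h : ∀ K : Set (SpaceTime n), IsCompact K → MemLp f 2 (volume.restrict K)) :
    LocallyIntegrable f := by
  rw [locallyIntegrable_iff]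
  intro K hK
  have : IsFiniteMeasure (volume.restrict K) := ⟨by simpa using hK.measure_lt_top⟩
  exact (h K hK).integrable one_le_two

theorem spaceDeriv_slice {φ : SpaceTime n → ℂ} (hφ : IsTestFunction φ) (k : Fin n) (x : Space n)
    (t : ℝ) :
    fderiv ℝ (fun y => φ (y, t)) x (EuclideanSpace.single k 1) = spaceDeriv k φ (x, t) := by
  have h1 : HasFDerivAt φ (fderiv ℝ φ (x, t)) (x, t) :=
    (hφ.smooth.differentiable (by simp) (x, t)).hasFDerivAt
  have h2 := h1.comp x (hasFDerivAt_prodMk_left (𝕜 := ℝ) x t)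
  rw [show (fun y => φ (y, t)) = φ ∘ (fun y => (y, t)) from rfl, h2.fderiv]
  simp [spaceDeriv]

theorem timeDeriv_slice {φ : SpaceTime n → ℂ} (hφ : IsTestFunction φ) (x : Space n) (t : ℝ) :
    HasDerivAt (fun s => φ (x, s)) (timeDeriv φ (x, t)) t := by
  have h1 : HasFDerivAt φ (fderiv ℝ φ (x, t)) (x, t) :=
    (hφ.smooth.differentiable (by simp) (x, t)).hasFDerivAt
  have h2 := (h1.comp t (hasFDerivAt_prodMk_right (𝕜 := ℝ) x t)).hasDerivAt
  simpa [timeDeriv] using! h2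

theorem IsTestFunction.fderiv_apply {φ : SpaceTime n → ℂ} (hφ : IsTestFunction φ)
    (v : SpaceTime n) :
    IsTestFunction (fun z => fderiv ℝ φ z v) where
  smooth := (hφ.smooth.fderiv_right (m := ∞) (by simp)).clm_apply contDiff_const
  compactSupport := hφ.compactSupport.fderiv_apply ℝ v

theorem spaceDeriv_timeDeriv {φ : SpaceTime n → ℂ} (hφ : IsTestFunction φ) (k : Fin n) :
    spaceDeriv k (timeDeriv φ) = timeDeriv (spaceDeriv k φ) := by
  ext z
  have hd : DifferentiableAt ℝ (fderiv ℝ φ) z :=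
    (hφ.smooth.fderiv_right (m := ∞) (by simp)).differentiable (by simp) z
  have hs := (hφ.smooth.contDiffAt (x := z)).isSymmSndFDerivAt
      (by simpa using! WithTop.coe_le_coe.2 (OrderTop.le_top (2 : ℕ∞)))
  have h1 : ∀ v w : SpaceTime n, fderiv ℝ (fun y => fderiv ℝ φ y v) z w = fderiv ℝ
      (fderiv ℝ φ) z w v := by
    intro v w
    rw [fderiv_clm_apply hd (differentiableAt_const v)]
    simp
  unfold spaceDeriv timeDeriv
  rw [h1, h1]
  exact hs _ _

theorem IsTestFunction.slice_left {φ : SpaceTime n → ℂ} (hφ : IsTestFunction φ) (t : ℝ) :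
    HasCompactSupport fun x : Space n => φ (x, t) := by
  refine HasCompactSupport.intro (hφ.compactSupport.isCompact.image continuous_fst)
    fun x hx => image_eq_zero_of_notMem_tsupport fun h => hx ⟨_, h, rfl⟩

theorem IsTestFunction.slice_right {φ : SpaceTime n → ℂ} (hφ : IsTestFunction φ) (x : Space n) :
    HasCompactSupport fun t : ℝ => φ (x, t) := by
  refine HasCompactSupport.intro (hφ.compactSupport.isCompact.image continuous_snd)
    fun t ht => image_eq_zero_of_notMem_tsupport fun h => ht ⟨_, h, rfl⟩

theorem integrable_mul_testFunction {f φ : SpaceTime n → ℂ} (hf : LocallyIntegrable f)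
    (hφ : IsTestFunction φ) : Integrable fun z => f z * φ z :=
  hf.integrable_smul_right_of_hasCompactSupport hφ.smooth.continuous hφ.compactSupport

/-- Integration by parts in `x` on almost every time slice, for functions that may be singular at
`t = 0`. -/
theorem integral_mul_spaceDeriv {f f' : SpaceTime n → ℂ} {k : Fin n} (hf : LocallyIntegrable f)
    (hf' : LocallyIntegrable f') (hd : ∀ t ≠ 0, Differentiable ℝ fun x => f (x, t))
    (hd' : ∀ t ≠ 0, ∀ x, fderiv ℝ (fun x => f (x, t)) x (EuclideanSpace.single k 1) = f' (x, t))
    (hc : ∀ t ≠ 0, Continuous fun x => f' (x, t)) {φ : SpaceTime n → ℂ} (hφ : IsTestFunction φ) :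
    ∫ z, f z * spaceDeriv k φ z = -∫ z, f' z * φ z := by
  have hφ' : IsTestFunction (spaceDeriv k φ) := hφ.fderiv_apply _
  have i1 := integrable_mul_testFunction hf hφ'
  have i2 := integrable_mul_testFunction hf' hφ
  rw [Measure.volume_eq_prod] at i1 i2 ⊢
  rw [integral_prod_symm _ i1, integral_prod_symm _ i2, ← integral_neg]
  refine integral_congr_ae ?_
  have h : ∀ᵐ t : ℝ, t ≠ 0 := by simp [ae_iff]
  filter_upwards [h] with t ht
  have hs : Continuous fun x : Space n => φ (x, t) :=
    hφ.smooth.continuous.comp (by fun_prop)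
  have hs' : Continuous fun x : Space n => spaceDeriv k φ (x, t) :=
    hφ'.smooth.continuous.comp (by fun_prop)
  have key := integral_mul_fderiv_eq_neg_fderiv_mul_of_integrable
      (μ := (volume : Measure (Space n)))
    (f := fun x => f (x, t)) (g := fun x => φ (x, t)) (v := EuclideanSpace.single k 1) ?_ ?_ ?_
    (fun x _ => hd t ht x) (fun x _ => (hφ.smooth.differentiable (by simp)).comp
      (by fun_prop : Differentiable ℝ fun x : Space n => (x, t)) x)
  · simpa only [spaceDeriv_slice hφ, hd' t ht] using key
  · simp only [hd' t ht]
    exact ((hc t ht).mul hs).integrable_of_hasCompactSupport (hφ.slice_left t).mul_left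
  · simp only [spaceDeriv_slice hφ]
    exact ((hd t ht).continuous.mul hs').integrable_of_hasCompactSupport (hφ'.slice_left t).mul_left
  · exact ((hd t ht).continuous.mul hs).integrable_of_hasCompactSupport (hφ.slice_left t).mul_left

theorem integral_eq_zero_of_hasDerivAt_of_ne {h h' : ℝ → ℂ} {a : ℝ} (hc : Continuous h)
    (hs : HasCompactSupport h) (hd : ∀ t ≠ a, HasDerivAt h (h' t) t) (hi : Integrable h') :
    ∫ t, h' t = 0 := by
  have h1 := integral_Iic_of_hasDerivAt_of_tendsto (a := a) hc.continuousWithinAt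
    (fun t (ht : t < a) => hd t ht.ne) hi.integrableOn
    (hs.is_zero_at_infty.mono_left (by rw [cocompact_eq_atBot_atTop]; exact le_sup_left))
  have h2 := integral_Ioi_of_hasDerivAt_of_tendsto (a := a) hc.continuousWithinAt
    (fun t (ht : a < t) => hd t ht.ne') hi.integrableOn
    (hs.is_zero_at_infty.mono_left (by rw [cocompact_eq_atBot_atTop]; exact le_sup_right))
  rw [← intervalIntegral.integral_Iic_add_Ioi (b := a) hi.integrableOn hi.integrableOn, h1, h2]
  ring

/-- Integration by parts in `t` along almost every line `{x} × ℝ`, for functions that are continuous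
on the line and differentiable off `t = 0`. -/
theorem integral_mul_timeDeriv (hn : 0 < n) {f f' : SpaceTime n → ℂ} (hf : LocallyIntegrable f)
    (hf' : LocallyIntegrable f') (hc : ∀ x ≠ 0, Continuous fun t => f (x, t))
    (hd : ∀ x ≠ 0, ∀ t ≠ 0, HasDerivAt (fun s => f (x, s)) (f' (x, t)) t)
    {φ : SpaceTime n → ℂ} (hφ : IsTestFunction φ) :
    ∫ z, f' z * φ z = -∫ z, f z * timeDeriv φ z := by
  have : Nonempty (Fin n) := ⟨⟨0, hn⟩⟩
  have hφ' : IsTestFunction (timeDeriv φ) := hφ.fderiv_apply _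
  have i1 := integrable_mul_testFunction hf hφ'
  have i2 := integrable_mul_testFunction hf' hφ
  rw [eq_neg_iff_add_eq_zero, ← integral_add i2 i1]
  have i3 : Integrable fun z => f' z * φ z + f z * timeDeriv φ z := i2.add i1
  rw [Measure.volume_eq_prod] at i3 ⊢
  rw [integral_prod _ i3]
  refine integral_eq_zero_of_ae ?_
  have h : ∀ᵐ x : Space n, x ≠ 0 := by simp [ae_iff]
  filter_upwards [h, i3.prod_right_ae] with x hx hix
  exact integral_eq_zero_of_hasDerivAt_of_ne (a := 0) (h := fun t => f (x, t) * φ (x, t))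
    ((hc x hx).mul (hφ.smooth.continuous.comp (by fun_prop))) (hφ.slice_right x).mul_left
    (fun t ht => (hd x hx t ht).mul (timeDeriv_slice hφ x t)) hix

/-! ### The equation -/

/-- A measurable function that is continuous on `[0, 1]`; there it is bounded, and
the values elsewhere play no role. -/
structure IsRegularProfile (P : ℝ → ℂ) : Prop where
  measurable : Measurable P
  continuousAt : ∀ q ∈ Icc (0 : ℝ) 1, ContinuousAt P q

theorem IsRegularProfile.exists_bound {P Q : ℝ → ℂ} (hP : IsRegularProfile P)
    (hQ : IsRegularProfile Q) :
    ∃ K : ℝ, (∀ q ∈ Icc (0 : ℝ) 1, ‖P q‖ ≤ K) ∧ ∀ q ∈ Icc (0 : ℝ) 1, ‖Q q‖ ≤ K := by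
  obtain ⟨K, hK⟩ := isCompact_Icc.exists_bound_of_continuousOn
    (fun q hq => (hP.continuousAt q hq).continuousWithinAt : ContinuousOn P (Icc (0 : ℝ) 1))
  obtain ⟨L, hL⟩ := isCompact_Icc.exists_bound_of_continuousOn
    (fun q hq => (hQ.continuousAt q hq).continuousWithinAt : ContinuousOn Q (Icc (0 : ℝ) 1))
  exact ⟨max K L, fun q hq => (hK q hq).trans (le_max_left _ _),
    fun q hq => (hL q hq).trans (le_max_right _ _)⟩

theorem IsRegularProfile.radialProfile {α : ℝ} {P P' : ℝ → ℂ} (hP : IsRegularProfile P)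
    (hP' : IsRegularProfile P') :
    IsRegularProfile (radialProfile α P P') where
  measurable := by
    have := hP.measurable
    have := hP'.measurable
    unfold _root_.radialProfile; fun_prop
  continuousAt q hq := by
    have := hP.continuousAt q hq
    have := hP'.continuousAt q hq
    unfold _root_.radialProfile; fun_prop

theorem IsRegularProfile.backwardProfile {α : ℝ} {P P' : ℝ → ℂ} (hP : IsRegularProfile P)
    (hP' : IsRegularProfile P') :
    IsRegularProfile (backwardProfile α P P') where
  measurable := by
    have := hP.measurable
    have := hP'.measurable
    unfold _root_.backwardProfile; fun_prop
  continuousAt q hq := by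
    have := hP.continuousAt q hq
    have := hP'.continuousAt q hq
    unfold _root_.backwardProfile; fun_prop

theorem IsRegularProfile.forwardProfile {α : ℝ} {P P' : ℝ → ℂ} (hP : IsRegularProfile P)
    (hP' : IsRegularProfile P') :
    IsRegularProfile (forwardProfile α P P') where
  measurable := by
    have := hP.measurable
    have := hP'.measurable
    unfold _root_.forwardProfile; fun_prop
  continuousAt q hq := by
    have := hP.continuousAt q hq
    have := hP'.continuousAt q hq
    unfold _root_.forwardProfile; fun_prop

theorem IsProfile.regular {α : ℝ} {Γ Γ' U U' : ℝ → ℂ}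
    (h : IsProfile n α Γ Γ' U U') : IsRegularProfile Γ :=
  ⟨h.measurable, fun q hq => (h.hasDerivAt q hq).continuousAt⟩

theorem IsProfile.regular_deriv {α : ℝ} {Γ Γ' U U' : ℝ → ℂ}
    (h : IsProfile n α Γ Γ' U U') : IsRegularProfile Γ' :=
  ⟨h.measurable_deriv, h.continuousAt_deriv⟩

theorem IsProfile.regular_U {α : ℝ} {Γ Γ' U U' : ℝ → ℂ}
    (h : IsProfile n α Γ Γ' U U') : IsRegularProfile U :=
  ⟨h.measurable_U, fun q hq => (h.hasDerivAt_U q hq).continuousAt⟩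

theorem IsProfile.regular_derivU {α : ℝ} {Γ Γ' U U' : ℝ → ℂ}
    (h : IsProfile n α Γ Γ' U U') : IsRegularProfile U' :=
  ⟨h.measurable_derivU, h.continuousAt_derivU⟩

theorem norm_coord_le (x : Space n) (k : Fin n) : ‖(x k : ℂ)‖ ≤ ‖x‖ := by
  rw [Complex.norm_real]; exact PiLp.norm_apply_le x k

theorem memLp_two_of_le_norm_pow {E : Type*} [NormedAddCommGroup E] (hn : 0 < n) {α β C : ℝ}
    (hα0 : 0 < α) (hα : 4 * α < n) (m : ℕ) (hβ : β - m / 2 ≤ α + 1 / 2) (hC : 0 ≤ C)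
    {f : SpaceTime n → E}
    (hf : AEStronglyMeasurable f) (hle : ∀ z, ‖f z‖ ≤ C * ‖z.1‖ ^ m * parabolicSq z ^ (-β))
    {K : Set (SpaceTime n)} (hK : IsCompact K) : MemLp f 2 (volume.restrict K) := by
  refine memLp_two_of_le_parabolicSq_rpow hn (β := α + 1 / 2) (γ := β - m / 2) (C := C)
    (by positivity) (by linarith) hβ hf (fun z hz => (hle z).trans ?_) hK
  have hN := parabolicSq_pos_of_fst hz
  have h1 : ‖z.1‖ ^ m ≤ parabolicSq z ^ ((m : ℝ) / 2) := by
    rw [div_eq_inv_mul, Real.rpow_mul hN.le, Real.rpow_natCast]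
    refine pow_le_pow_left₀ (norm_nonneg _) ?_ m
    rw [← one_div, ← Real.sqrt_eq_rpow]
    exact Real.le_sqrt_of_sq_le (by simp [parabolicSq])
  rw [show -(β - m / 2) = (m : ℝ) / 2 + -β by ring, Real.rpow_add hN, ← mul_assoc]
  gcongr

theorem locallyIntegrable_coord_pow_mul_selfSimilar (hn : 0 < n) {α β : ℝ} (hα0 : 0 < α)
    (hα : 4 * α < n) (m : ℕ) (hβ : β - m / 2 ≤ α + 1 / 2) {P Q : ℝ → ℂ} (hP : IsRegularProfile P)
    (hQ : IsRegularProfile Q) (k : Fin n) (c : ℂ) :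
    LocallyIntegrable fun z : SpaceTime n => c * (z.1 k : ℂ) ^ m * selfSimilar β P Q z := by
  obtain ⟨B, hB1, hB2⟩ := hP.exists_bound hQ
  have hB0 : 0 ≤ B := (norm_nonneg _).trans (hB1 0 (by simp))
  refine locallyIntegrable_of_memLp_two fun K hK => memLp_two_of_le_norm_pow hn hα0 hα m hβ
    (C := ‖c‖ * B) (by positivity) ?_ ?_ hK
  · have := measurable_selfSimilar (n := n) (β := β) hP.measurable hQ.measurable
    have h2 : Measurable fun z : SpaceTime n => (z.1 k : ℂ) := by fun_prop
    exact ((h2.pow_const m).const_mul c).mul this |>.aestronglyMeasurable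
  · intro z
    rw [norm_mul, norm_mul, norm_pow]
    have h1 := norm_selfSimilar_le (β := β) hB1 hB2 z
    calc ‖c‖ * ‖(z.1 k : ℂ)‖ ^ m * ‖selfSimilar β P Q z‖
        ≤ ‖c‖ * ‖z.1‖ ^ m * (B * parabolicSq z ^ (-β)) := by
          gcongr
          exact norm_coord_le _ _
      _ = _ := by ring

theorem locallyIntegrable_selfSimilar (hn : 0 < n) {α β : ℝ} (hα0 : 0 < α)
    (hα : 4 * α < n) (hβ : β ≤ α + 1 / 2) {P Q : ℝ → ℂ} (hP : IsRegularProfile P)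
      (hQ : IsRegularProfile Q) :
    LocallyIntegrable (selfSimilar (n := n) β P Q) := by
  simpa using locallyIntegrable_coord_pow_mul_selfSimilar hn hα0 hα 0 (β := β) (by simpa using hβ)
    hP hQ ⟨0, hn⟩ 1

theorem fderiv_selfSimilar_single {α : ℝ} {P P' Q Q' : ℝ → ℂ}
    (hP : ∀ q ∈ Icc (0 : ℝ) 1, HasDerivAt P (P' q) q)
    (hQ : ∀ q ∈ Icc (0 : ℝ) 1, HasDerivAt Q (Q' q) q) {t : ℝ} (ht : t ≠ 0) (x : Space n)
      (k : Fin n) :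
    fderiv ℝ (fun y : Space n => selfSimilar α P Q (y, t)) x (EuclideanSpace.single k 1) =
      2 * (x k : ℂ) * selfSimilar (α + 1) (radialProfile α P P') (radialProfile α Q Q') (x, t) := by
  rw [(hasFDerivAt_selfSimilar hP hQ ht x).fderiv]
  simp [EuclideanSpace.inner_single_right]

theorem continuous_selfSimilar_slice {β : ℝ} {P Q : ℝ → ℂ} (hP : IsRegularProfile P)
    (hQ : IsRegularProfile Q)
    {t : ℝ} (ht : t ≠ 0) : Continuous fun x : Space n => selfSimilar β P Q (x, t) :=
  continuous_iff_continuousAt.2 fun x => ContinuousAt.comp (f := fun x : Space n => (x, t))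
    (continuousAt_selfSimilar hP.continuousAt hQ.continuousAt ht) (by fun_prop)

theorem continuous_coord (k : Fin n) : Continuous fun x : Space n => (x k : ℂ) := by fun_prop

/-- The field `2 c x`, which is the spatial gradient of a radial function with derivative `c` in
`‖x‖ ^ 2`. -/
noncomputable def radialGradient (c : SpaceTime n → ℂ) (z : SpaceTime n) :
    EuclideanSpace ℂ (Fin n) :=
  WithLp.toLp 2 fun k => 2 * (z.1 k : ℂ) * c z

theorem norm_radialGradient (c : SpaceTime n → ℂ) (z : SpaceTime n) :
    ‖radialGradient c z‖ = 2 * ‖z.1‖ * ‖c z‖ := by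
  have h : radialGradient c z = (2 * c z) • (WithLp.toLp 2 fun k => (z.1 k : ℂ) : EuclideanSpace ℂ
      (Fin n)) := by
    ext k; simp [radialGradient]; ring
  rw [h, norm_smul, norm_mul, EuclideanSpace.norm_eq, EuclideanSpace.norm_eq]
  simp
  ring

theorem hasFDerivAt_coord (c : ℂ) (k : Fin n) (x : Space n) :
    HasFDerivAt (fun y : Space n => c * (y k : ℂ))
      (c • Complex.ofRealCLM.comp (EuclideanSpace.proj k : Space n →L[ℝ] ℝ)) x :=
  (Complex.ofRealCLM.comp (EuclideanSpace.proj k : Space n →L[ℝ] ℝ)).hasFDerivAt.const_mul c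

theorem measurable_radialGradient {c : SpaceTime n → ℂ} (hc : Measurable c) :
    Measurable (radialGradient c) := by
  refine (WithLp.measurable_toLp 2 _).comp (measurable_pi_lambda _ fun k => ?_)
  have : Measurable fun z : SpaceTime n => (z.1 k : ℂ) := by fun_prop
  fun_prop

theorem hasWeakSpatialGradient_selfSimilar (hn : 0 < n) {α : ℝ} (hα0 : 0 < α) (hα : 4 * α < n)
    {P P' Q Q' : ℝ → ℂ} (hP : ∀ q ∈ Icc (0 : ℝ) 1, HasDerivAt P (P' q) q)
    (hQ : ∀ q ∈ Icc (0 : ℝ) 1, HasDerivAt Q (Q' q) q) (rP : IsRegularProfile P)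
      (rQ : IsRegularProfile Q)
    (rP' : IsRegularProfile P') (rQ' : IsRegularProfile Q') :
    HasWeakSpatialGradient (selfSimilar (n := n) α P Q)
      (radialGradient (selfSimilar (α + 1) (radialProfile α P P') (radialProfile α Q Q'))) := by
  have rW := rP.radialProfile (α := α) rP'
  have rZ := rQ.radialProfile (α := α) rQ'
  refine ⟨fun K hK => ?_, fun K hK => ?_, fun k φ hφ => ?_⟩
  · obtain ⟨B, hB1, hB2⟩ := rP.exists_bound rQ
    refine memLp_two_of_le_norm_pow hn hα0 hα 0 (β := α) (C := B) (by simp)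
      ((norm_nonneg _).trans (hB1 0 (by simp)))
      (measurable_selfSimilar rP.measurable rQ.measurable).aestronglyMeasurable (fun z => ?_) hK
    simpa using norm_selfSimilar_le hB1 hB2 z
  · obtain ⟨B, hB1, hB2⟩ := rW.exists_bound rZ
    have hB0 : 0 ≤ B := (norm_nonneg _).trans (hB1 0 (by simp))
    refine memLp_two_of_le_norm_pow hn hα0 hα 1 (β := α + 1) (C := 2 * B) (by norm_num; linarith)
      (by positivity)
      (measurable_radialGradient
        (measurable_selfSimilar rW.measurable rZ.measurable)).aestronglyMeasurable
      (fun z => ?_) hK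
    rw [norm_radialGradient]
    calc _ ≤ 2 * ‖z.1‖ * (B * parabolicSq z ^ (-(α + 1))) := by
          gcongr; exact norm_selfSimilar_le hB1 hB2 z
      _ = _ := by ring
  · refine integral_mul_spaceDeriv (locallyIntegrable_selfSimilar hn hα0 hα (by linarith) rP rQ)
      (by
        simpa [radialGradient] using locallyIntegrable_coord_pow_mul_selfSimilar hn hα0 hα 1
          (by norm_num; linarith) rW rZ k 2)
      (fun t ht x => (hasFDerivAt_selfSimilar hP hQ ht x).differentiableAt)
      (fun t ht x => fderiv_selfSimilar_single hP hQ ht x k)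
      (fun t ht => ?_) hφ
    exact (continuous_const.mul (continuous_coord k)).mul (continuous_selfSimilar_slice rW rZ ht)

theorem sum_coord_sq (x : Space n) : ∑ k, (x k : ℂ) ^ 2 = ((‖x‖ ^ 2 : ℝ) : ℂ) := by
  rw [EuclideanSpace.norm_sq_eq]
  push_cast
  simp [← Complex.ofReal_pow]

/-- The divergence of `N ^ (-α) Γ(q) x / n`, summed from its partial derivatives, is
`N ^ (-α) U(q)`. -/
theorem div_radial_field (hn : 0 < n) {α : ℝ} (hα : 0 < α) {Γ Γ' U U' Δ Δ' Z Z' : ℝ → ℂ}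
    (h : IsProfile n α Γ Γ' U U')
    (h' : IsProfile n α Δ Δ' Z Z') (z : SpaceTime n) :
    ∑ k : Fin n, (1 / n * selfSimilar α Γ Δ z + 2 / n * (z.1 k : ℂ) ^ 2
        * selfSimilar (α + 1) (radialProfile α Γ Γ')
          (radialProfile α Δ Δ') z) = selfSimilar α U Z z := by
  have hn' : (n : ℂ) ≠ 0 := by exact_mod_cast hn.ne'
  rw [Finset.sum_add_distrib, Finset.sum_const, ← Finset.sum_mul, ← Finset.mul_sum, sum_coord_sq]
  simp only [Finset.card_univ, Fintype.card_fin, nsmul_eq_mul]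
  rcases (parabolicSq_nonneg z).eq_or_lt with hN | hN
  · have h0 : z.1 = 0 := by
      by_contra hz; exact (parabolicSq_pos_of_fst hz).ne hN
    simp [selfSimilar, ← hN, h0, Real.zero_rpow (neg_ne_zero.2 hα.ne')]
  · rw [norm_sq_eq hN]
    have e : parabolicSq z ^ (-α) = parabolicSq z ^ (-(α + 1)) * parabolicSq z := by
      rw [← Real.rpow_add_one hN.ne']; ring_nf
    unfold selfSimilar radialProfile
    rw [h.eq, h'.eq, e]
    split_ifs <;> push_cast <;> field_simp <;> ring

/-- The equation `u_t = div F` in the sense of distributions, for `u = div V` and `F = V_t` with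
`V = N ^ (-α) Γ(q) x / n`. Both sides pair with a test function to the same multiple of
`∫ V · ∇ φ_t`; for this it suffices that `V` is continuous across `t = 0`. -/
theorem selfSimilar_equation (hn : 0 < n) {α : ℝ} (hα0 : 0 < α) (hα : 4 * α < n)
    {Γ Γ' U U' Δ Δ' Z Z' : ℝ → ℂ} (h : IsProfile n α Γ Γ' U U')
    (h' : IsProfile n α Δ Δ' Z Z') (h0 : Γ 0 = Δ 0) {φ : SpaceTime n → ℂ} (hφ : IsTestFunction φ) :
    ∫ z, (-(selfSimilar α U Z z * timeDeriv φ z) + ∑ k : Fin n, 1 / n * (z.1 k : ℂ)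
      * selfSimilar (α + 1) (backwardProfile α Γ Γ')
        (forwardProfile α Δ Δ') z * spaceDeriv k φ z) = 0 := by
  have rW := h.regular.radialProfile (α := α) h.regular_deriv
  have rZ := h'.regular.radialProfile (α := α) h'.regular_deriv
  have rB := h.regular.backwardProfile (α := α) h.regular_deriv
  have rF := h'.regular.forwardProfile (α := α) h'.regular_deriv
  have hφt : IsTestFunction (timeDeriv φ) := hφ.fderiv_apply _
  have hφk : ∀ k, IsTestFunction (spaceDeriv k φ) := fun k => hφ.fderiv_apply _
  have lU := locallyIntegrable_selfSimilar hn hα0 hα (β := α) (by linarith) h.regular_U h'.regular_U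
  have lG := locallyIntegrable_selfSimilar hn hα0 hα (β := α) (by linarith) h.regular h'.regular
  have lF : ∀ k : Fin n, LocallyIntegrable fun z : SpaceTime n => 1 / n * (z.1 k : ℂ)
      * selfSimilar (α + 1) (backwardProfile α Γ Γ') (forwardProfile α Δ Δ') z := fun k => by
    simpa using locallyIntegrable_coord_pow_mul_selfSimilar hn hα0 hα 1
        (by norm_num; linarith) rB rF k (1 / n)
  have lV : ∀ k : Fin n, LocallyIntegrable fun z : SpaceTime n => 1 / n * (z.1 k : ℂ)
      * selfSimilar α Γ Δ z := fun k => by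
    simpa using locallyIntegrable_coord_pow_mul_selfSimilar hn hα0 hα 1 (by norm_num; linarith)
      h.regular h'.regular k (1 / n)
  have lD : ∀ k : Fin n, LocallyIntegrable fun z : SpaceTime n => 1 / n * selfSimilar α Γ Δ z
      + 2 / n * (z.1 k : ℂ) ^ 2
        * selfSimilar (α + 1) (radialProfile α Γ Γ') (radialProfile α Δ Δ') z := fun k =>
    (lG.smul (1 / n : ℂ)).add
      (locallyIntegrable_coord_pow_mul_selfSimilar hn hα0 hα 2 (by norm_num) rW rZ k (2 / n))
  have key : ∀ k : Fin n, ∫ z : SpaceTime n, 1 / n * (z.1 k : ℂ)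
      * selfSimilar (α + 1) (backwardProfile α Γ Γ') (forwardProfile α Δ Δ') z * spaceDeriv k φ z
      = ∫ z : SpaceTime n, (1 / n * selfSimilar α Γ Δ z + 2 / n * (z.1 k : ℂ) ^ 2
        * selfSimilar (α + 1) (radialProfile α Γ Γ') (radialProfile α Δ Δ') z) * timeDeriv φ z := by
    intro k
    rw [integral_mul_timeDeriv hn (lV k) (lF k) ?_ ?_ (hφk k), ← spaceDeriv_timeDeriv hφ,
      integral_mul_spaceDeriv (lV k) (lD k) ?_ ?_ ?_ hφt, neg_neg]
    · intro t ht
      exact fun x => ((hasFDerivAt_coord _ k x).mul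
        (hasFDerivAt_selfSimilar h.hasDerivAt h'.hasDerivAt ht x)).differentiableAt
    · intro t ht x
      have e := ((hasFDerivAt_coord (1 / n) k x).mul
        (hasFDerivAt_selfSimilar (α := α) h.hasDerivAt h'.hasDerivAt ht x)).fderiv
      refine (DFunLike.congr_fun e _).trans ?_
      simp [EuclideanSpace.inner_single_right]
      ring
    · intro t ht
      exact (continuous_const.mul (continuous_selfSimilar_slice h.regular h'.regular ht)).add
        ((continuous_const.mul ((continuous_coord k).pow 2)).mul
          (continuous_selfSimilar_slice rW rZ ht))
    · intro x hx
      refine (continuous_const : Continuous fun _ : ℝ => 1 / (n : ℂ) * (x k : ℂ)).mul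
        (continuous_iff_continuousAt.2 fun t => ?_)
      have ct : ContinuousAt (fun t : ℝ => (x, t)) t := by fun_prop
      refine ContinuousAt.comp (g := selfSimilar α Γ Δ) ?_ ct
      rcases eq_or_ne t 0 with rfl | ht
      · exact continuousAt_selfSimilar_zero (h.regular.continuousAt 0 (by simp))
          (h'.regular.continuousAt 0 (by simp)) h0 hx
      · exact continuousAt_selfSimilar h.regular.continuousAt h'.regular.continuousAt ht
    · intro x _ t ht
      exact (hasDerivAt_selfSimilar h.hasDerivAt h'.hasDerivAt ht x).const_mul
          (1 / (n : ℂ) * (x k : ℂ))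
  have iU := (integrable_mul_testFunction lU hφt).fun_neg
  have iD := fun k => integrable_mul_testFunction (lD k) hφt
  rw [integral_add iU
    (integrable_finsetSum _ fun k _ => integrable_mul_testFunction (lF k) (hφk k)), integral_neg,
    integral_finsetSum _ fun k _ => integrable_mul_testFunction (lF k) (hφk k),
    Finset.sum_congr rfl fun k _ => key k, ← integral_finsetSum _ fun k _ => iD k]
  simp_rw [← Finset.sum_mul, div_radial_field hn hα0 h h']
  ring

/-! ### Continuity in time, blow-up of norms, ellipticity -/

theorem continuousInL2Loc_of_continuousAt {u : SpaceTime n → ℂ} {I : Set ℝ}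
    (hu : ∀ x : Space n, ∀ t ∈ I, ContinuousAt u (x, t)) : ContinuousInL2Loc u I := by
  intro R t ht
  have hfin : IsFiniteMeasure (volume.restrict (Metric.ball (0 : Space n) R)) :=
    ⟨by simpa using measure_ball_lt_top⟩
  have hct : ∀ s ∈ I, Continuous fun x : Space n => u (x, s) := fun s hs =>
    continuous_iff_continuousAt.2 fun x => by
      have cx : ContinuousAt (fun x : Space n => (x, s)) x := by fun_prop
      exact ContinuousAt.comp (g := u) (hu x s hs) cx
  have hK : IsCompact (Metric.closedBall (0 : Space n) R) := isCompact_closedBall _ _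
  constructor
  · obtain ⟨C, hC⟩ := hK.exists_bound_of_continuousOn (hct t ht).continuousOn
    refine MemLp.of_bound (hct t ht).aestronglyMeasurable C ?_
    filter_upwards [ae_restrict_mem measurableSet_ball] with x hx
    exact hC x (Metric.ball_subset_closedBall hx)
  · have hunif : ∀ η > 0, ∀ᶠ s in 𝓝 t, ∀ x ∈ Metric.closedBall (0 : Space n) R,
        ‖u (x, s) - u (x, t)‖ ≤ η := by
      intro η hη
      refine hK.eventually_forall_of_forall_eventually fun x _ => ?_
      have h1 : ContinuousAt (fun p : ℝ × Space n => (p.2, p.1)) (t, x) := by fun_prop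
      have h2 : ContinuousAt (fun p : ℝ × Space n => u (p.2, p.1)) (t, x) :=
        ContinuousAt.comp (g := u) (hu x t ht) h1
      have h3 : ContinuousAt (fun p : ℝ × Space n => u (p.2, t)) (t, x) :=
        ((hct t ht).comp continuous_snd).continuousAt
      have h4 := (h2.sub h3).norm
      have h5 : ∀ᶠ p : ℝ × Space n in 𝓝 (t, x), ‖u (p.2, p.1) - u (p.2, t)‖ < η :=
        h4.eventually_lt continuousAt_const (by simpa using hη)
      exact h5.mono fun p hp => hp.le
    set m := (volume.restrict (Metric.ball (0 : Space n) R)) univ ^ (2 : ℝ≥0∞).toReal⁻¹ with hm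
    have hmtop : m ≠ ⊤ := ENNReal.rpow_ne_top_of_nonneg (by simp) (measure_ne_top _ _)
    have h0 : Tendsto (fun η : ℝ => m * ENNReal.ofReal η) (𝓝[>] 0) (𝓝 0) := by
      have := ENNReal.Tendsto.const_mul (a := m) (ENNReal.tendsto_ofReal
        (tendsto_id.mono_left nhdsWithin_le_nhds : Tendsto (fun η : ℝ => η) (𝓝[>] 0) (𝓝 0)))
        (Or.inr hmtop)
      simpa using this
    rw [ENNReal.tendsto_nhds_zero]
    intro e he
    obtain ⟨η, hη, hη0⟩ := ((h0.eventually_le_const he).and self_mem_nhdsWithin).exists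
    filter_upwards [nhdsWithin_le_nhds (hunif η hη0)] with s hs
    refine (eLpNorm_le_of_ae_bound (C := η) ?_).trans hη
    filter_upwards [ae_restrict_mem measurableSet_ball] with x hx
    exact hs x (Metric.ball_subset_closedBall hx)

theorem ofReal_mul_rpow_le_eLpNorm {X E : Type*} [MeasurableSpace X] [NormedAddCommGroup E]
    {μ : Measure X} {p : ℝ} (hp : 0 < p) {f : X → E} {S : Set X} (hS : MeasurableSet S) {c m : ℝ}
    (hc : 0 ≤ c) (hm : 0 ≤ m) (hmS : ENNReal.ofReal m ≤ μ S) (hf : ∀ x ∈ S, c ≤ ‖f x‖) :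
    ENNReal.ofReal (c * m ^ (1 / p)) ≤ eLpNorm f (ENNReal.ofReal p) μ := by
  have h1 : eLpNorm (S.indicator fun _ => c) (ENNReal.ofReal p) μ ≤ eLpNorm f
      (ENNReal.ofReal p) μ := by
    refine eLpNorm_mono fun x => ?_
    by_cases hx : x ∈ S
    · simpa [hx, abs_of_nonneg hc] using hf x hx
    · simp [hx]
  refine le_trans ?_ h1
  rw [eLpNorm_indicator_const hS (by simpa using hp) (by simp), ENNReal.toReal_ofReal hp.le,
    ENNReal.ofReal_mul hc, Real.enorm_of_nonneg hc,
    ← ENNReal.ofReal_rpow_of_nonneg hm (by positivity)]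
  gcongr

/-- If `‖f t‖ ≥ c t ^ (-a)` on a set of measure at least `m t ^ b`, and `a > b / p`, then
the `L ^ p` norms of `f t` blow up as `t → 0`. -/
theorem tendsto_eLpNorm_top {X E : Type*} [MeasurableSpace X] [NormedAddCommGroup E] {p : ℝ}
    (hp : 0 < p) {f : ℝ → X → E} {μ : ℝ → Measure X} {c m a b : ℝ} (hc : 0 < c) (hm : 0 < m)
    (hab : b / p < a) {S : ℝ → Set X} (hS : ∀ t, MeasurableSet (S t))
    (hmS : ∀ᶠ t in 𝓝[>] 0, ENNReal.ofReal (m * t ^ b) ≤ μ t (S t))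
    (hf : ∀ᶠ t in 𝓝[>] 0, ∀ x ∈ S t, c * t ^ (-a) ≤ ‖f t x‖) :
    Tendsto (fun t => eLpNorm (f t) (ENNReal.ofReal p) (μ t)) (𝓝[>] 0) (𝓝 ⊤) := by
  have h1 : Tendsto (fun t : ℝ => c * m ^ (1 / p) * t ^ (b / p - a)) (𝓝[>] 0) atTop :=
    (tendsto_rpow_neg_nhdsGT_zero (by linarith)).const_mul_atTop (by positivity)
  refine tendsto_nhds_top_mono (ENNReal.tendsto_ofReal_atTop.comp h1) ?_
  filter_upwards [hmS, hf, self_mem_nhdsWithin] with t h2 h3 (ht : 0 < t)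
  refine le_trans (le_of_eq ?_) (ofReal_mul_rpow_le_eLpNorm hp (hS t)
    (c := c * t ^ (-a)) (m := m * t ^ b) (by positivity) (by positivity) h2 h3)
  rw [Function.comp_apply, Real.mul_rpow hm.le (by positivity), ← Real.rpow_mul ht.le,
      sub_eq_add_neg,
    Real.rpow_add ht]
  congr 1
  ring_nf

theorem volume_ball_eq (x : Space n) {r : ℝ} (hr : 0 < r) :
    volume (Metric.ball x r) = ENNReal.ofReal (r ^ n *
      (volume (Metric.ball (0 : Space n) 1)).toReal) := by
  rw [Measure.addHaar_ball_of_pos _ _ hr, ENNReal.ofReal_mul (by positivity),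
    ENNReal.ofReal_toReal measure_ball_lt_top.ne]
  simp

theorem volume_unit_ball_pos : 0 < (volume (Metric.ball (0 : Space n) 1)).toReal :=
  ENNReal.toReal_pos (Metric.measure_ball_pos _ _ one_pos).ne' measure_ball_lt_top.ne

theorem norm_selfSimilar_of_neg {β : ℝ} {P Q : ℝ → ℂ} {z : SpaceTime n} (hz : z.2 < 0) :
    ‖selfSimilar β P Q z‖ = parabolicSq z ^ (-β) * ‖P (timeRatio z)‖ := by
  rw [selfSimilar, if_pos hz, norm_mul, Complex.norm_real,
    Real.norm_of_nonneg (Real.rpow_nonneg (parabolicSq_nonneg z) _)]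

theorem sqrt_mul_pow {t : ℝ} (ht : 0 ≤ t) (ρ : ℝ) : (√t * ρ) ^ n = ρ ^ n * t ^ ((n : ℝ) / 2) := by
  rw [mul_pow, mul_comm, Real.sqrt_eq_rpow, ← Real.rpow_mul_natCast ht]
  ring_nf

/-- The slices at time `-t` are of size `t ^ (-α)` on a ball of radius comparable to `√t`. -/
theorem tendsto_eLpNorm_slice_top {α p : ℝ} (hα : 0 < α) (hp : 0 < p) (hαp : n < 2 * α * p)
    {P Q : ℝ → ℂ}
    (hP : ContinuousAt P 1) (hP1 : P 1 ≠ 0) :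
    Tendsto (fun t : ℝ => eLpNorm (fun x : Space n => selfSimilar α P Q (x, -t)) (ENNReal.ofReal p)
        (volume.restrict (Metric.ball 0 1))) (𝓝[>] 0) (𝓝 ⊤) := by
  obtain ⟨η, hη, hPη⟩ : ∃ η > 0, ∀ q, |q - 1| < η → ‖P 1‖ / 2 < ‖P q‖ := by
    have := hP.norm.eventually_const_lt (show ‖P 1‖ / 2 < ‖P 1‖ by linarith [norm_pos_iff.2 hP1])
    obtain ⟨η, hη, h⟩ := Metric.eventually_nhds_iff.1 this
    exact ⟨η, hη, fun q hq => h hq⟩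
  obtain ⟨ρ, hρ0, hρ1, hρη⟩ : ∃ ρ : ℝ, 0 < ρ ∧ ρ ≤ 1 ∧ ρ ≤ η :=
    ⟨min 1 η, lt_min one_pos hη, min_le_left _ _, min_le_right _ _⟩
  have hv := volume_unit_ball_pos (n := n)
  have hpos : ∀ᶠ t : ℝ in 𝓝[>] 0, 0 < t := self_mem_nhdsWithin
  have hsmall : ∀ᶠ t : ℝ in 𝓝[>] 0, 0 < t ∧ t < 1 :=
    hpos.and
      (nhdsWithin_le_nhds (gt_mem_nhds one_pos))
  refine tendsto_eLpNorm_top hp (c := ‖P 1‖ / 2 * 2 ^ (-α)) (a := α) (b := n / 2)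
    (m := ρ ^ n * (volume (Metric.ball (0 : Space n) 1)).toReal)
    (mul_pos (by linarith [norm_pos_iff.2 hP1]) (by positivity)) (by positivity)
    (by rw [div_div, div_lt_iff₀ (by positivity)]; linarith)
    (S := fun t => Metric.ball 0 (√t * ρ)) (fun t => measurableSet_ball) ?_ ?_
  · filter_upwards [hsmall] with t ⟨ht, ht1⟩
    have hs : √t ≤ 1 := Real.sqrt_le_one.2 ht1.le
    rw [Measure.restrict_apply measurableSet_ball, inter_eq_left.2 (Metric.ball_subset_ball
      (by nlinarith [Real.sqrt_nonneg t])), volume_ball_eq 0 (mul_pos (Real.sqrt_pos.2 ht) hρ0),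
      sqrt_mul_pow ht.le]
    apply le_of_eq; congr 1; ring
  · filter_upwards [hsmall] with t ⟨ht, ht1⟩ x hx
    rw [mem_ball_zero_iff] at hx
    have hx2 : ‖x‖ ^ 2 < t * ρ ^ 2 := by
      calc ‖x‖ ^ 2 < (√t * ρ) ^ 2 := by gcongr
        _ = _ := by rw [mul_pow, Real.sq_sqrt ht.le]
    have hρ2 : ρ ^ 2 ≤ ρ := by nlinarith
    have hN : 0 < parabolicSq (x, -t) := parabolicSq_pos_of_snd (by simpa using ht.ne')
    have hN' : parabolicSq (x, -t) = ‖x‖ ^ 2 + t := by simp [parabolicSq, abs_of_pos ht]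
    have hN2 : parabolicSq (x, -t) ≤ 2 * t := by rw [hN']; nlinarith
    have hq : |timeRatio (x, -t) - 1| < η := by
      have h1 := (timeRatio_mem (x, -t)).2
      have h2 := norm_sq_eq hN
      rw [abs_of_nonpos (by linarith)]
      have h3 : t * (1 - timeRatio (x, -t)) ≤ ‖x‖ ^ 2 := by
        rw [show ‖x‖ ^ 2 = _ from h2, hN']
        exact mul_le_mul_of_nonneg_right (by linarith [sq_nonneg ‖x‖]) (by linarith)
      have h4 : t * (1 - timeRatio (x, -t)) < t * η := by nlinarith
      linarith [lt_of_mul_lt_mul_left h4 ht.le]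
    rw [norm_selfSimilar_of_neg (by simpa using ht), mul_assoc, ← Real.mul_rpow (by norm_num) ht.le,
      mul_comm]
    exact mul_le_mul (Real.rpow_le_rpow_of_nonpos hN hN2 (by linarith)) (hPη _ hq).le
        (by positivity)
      (Real.rpow_nonneg hN.le _)

/-- The gradient is of size `t ^ (-(α + 1 / 2))` on the product of a ball of radius `√t / 4`, at
distance `√t / 2` from the origin, with the time interval `(-2 t, -t)`. -/
theorem tendsto_eLpNorm_gradient_top (hn : 0 < n) {α p : ℝ} (hα : 0 < α) (hp : 2 < p)
    (hαp : n < 2 * α * p) {P Q : ℝ → ℂ} {c : ℝ} (hc : 0 < c) (hP : ∀ q ∈ Icc (0 : ℝ) 1, c ≤ ‖P q‖) :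
    Tendsto (fun t : ℝ => eLpNorm (radialGradient (selfSimilar (n := n) (α + 1) P Q))
      (ENNReal.ofReal p)
        (volume.restrict (Metric.ball (0 : Space n) 1 ×ˢ Ioo (-1 : ℝ) (-t)))) (𝓝[>] 0) (𝓝 ⊤) := by
  have hv := volume_unit_ball_pos (n := n)
  have hpos : ∀ᶠ t : ℝ in 𝓝[>] 0, 0 < t := self_mem_nhdsWithin
  have hsmall : ∀ᶠ t : ℝ in 𝓝[>] 0, 0 < t ∧ t < 1 / 2 :=
    hpos.and
      (nhdsWithin_le_nhds (gt_mem_nhds (by norm_num)))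
  let e : Space n := EuclideanSpace.single ⟨0, hn⟩ 1
  have he : ‖e‖ = 1 := by simp [e]
  refine tendsto_eLpNorm_top (by linarith) (c := 1 / 2 * (3 ^ (-(α + 1)) * c)) (a := α + 1 / 2)
    (b := n / 2 + 1) (m := (1 / 4) ^ n * (volume (Metric.ball (0 : Space n) 1)).toReal)
    (by positivity) (by positivity)
    (by rw [div_lt_iff₀ (by linarith)]; nlinarith)
    (S := fun t => Metric.ball ((√t / 2) • e) (√t * (1 / 4)) ×ˢ Ioo (-(2 * t)) (-t))
    (fun t => measurableSet_ball.prod measurableSet_Ioo) ?_ ?_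
  all_goals
    filter_upwards [hsmall] with t ⟨ht, ht1⟩
    have hst := Real.sqrt_pos.2 ht
    have hs : √t ≤ 1 := Real.sqrt_le_one.2 (by linarith)
    have hball : ∀ x ∈ Metric.ball ((√t / 2) • e) (√t * (1 / 4)),
        √t / 4 ≤ ‖x‖ ∧ ‖x‖ ≤ √t * (3 / 4) := by
      intro x hx
      rw [mem_ball_iff_norm] at hx
      have h1 : ‖(√t / 2) • e‖ = √t / 2 := by
        rw [norm_smul, he, mul_one, Real.norm_of_nonneg (by positivity)]
      have h2 := norm_sub_norm_le x ((√t / 2) • e)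
      have h3 := norm_sub_norm_le ((√t / 2) • e) x
      rw [norm_sub_rev] at h3
      constructor <;> linarith
  · rw [Measure.restrict_apply (measurableSet_ball.prod measurableSet_Ioo), inter_eq_left.2,
      Measure.volume_eq_prod, Measure.prod_prod, volume_ball_eq ((√t / 2) • e)
      (r := √t * (1 / 4)) (by positivity), sqrt_mul_pow ht.le,
      Real.volume_Ioo, ← ENNReal.ofReal_mul (by positivity), Real.rpow_add_one ht.ne']
    · apply le_of_eq; congr 1; ring
    · refine prod_mono (fun x hx => ?_) (Ioo_subset_Ioo_left (by linarith))
      rw [mem_ball_zero_iff]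
      linarith [(hball x hx).2]
  · rintro ⟨x, s⟩ ⟨hx, hs1, hs2⟩
    obtain ⟨hx1, hx2⟩ := hball x hx
    simp only at hs1 hs2
    have hs0 : s < 0 := by linarith
    have hN : 0 < parabolicSq (x, s) := parabolicSq_pos_of_snd hs0.ne
    have hN3 : parabolicSq (x, s) ≤ 3 * t := by
      have : ‖x‖ ^ 2 ≤ t := by
        calc ‖x‖ ^ 2 ≤ (√t) ^ 2 := by gcongr; linarith
          _ = t := Real.sq_sqrt ht.le
      simp only [parabolicSq, abs_of_neg hs0]
      linarith
    rw [norm_radialGradient, norm_selfSimilar_of_neg hs0]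
    have e1 : t ^ (-(α + 1 / 2)) = √t * t ^ (-(α + 1)) := by
      rw [Real.sqrt_eq_rpow, ← Real.rpow_add ht]; ring_nf
    calc 1 / 2 * (3 ^ (-(α + 1)) * c) * t ^ (-(α + 1 / 2))
        = 2 * (√t / 4) * ((3 * t) ^ (-(α + 1)) * c) := by
          rw [e1, Real.mul_rpow (by norm_num) ht.le]; ring
      _ ≤ 2 * ‖x‖ * (parabolicSq (x, s) ^ (-(α + 1)) * ‖P (timeRatio (x, s))‖) := by
          refine mul_le_mul (by linarith) ?_ (by positivity) (by positivity)
          exact mul_le_mul (Real.rpow_le_rpow_of_nonpos hN hN3 (by linarith))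
            (hP _ (timeRatio_mem _)) hc.le (Real.rpow_nonneg hN.le _)

theorem isElliptic_smul_one {a : SpaceTime n → ℂ} (ha : Measurable a) {lam Lam : ℝ}
    (h1 : ∀ z, lam ≤ (a z).re) (h2 : ∀ z, ‖a z‖ ≤ Lam) :
    IsElliptic (fun z => a z • (1 : Matrix (Fin n) (Fin n) ℂ)) lam Lam where
  measurable k l := by
    simp only [Matrix.smul_apply, Matrix.one_apply]
    fun_prop
  coercive z p := by
    have : (∑ k, ∑ l, (a z • (1 : Matrix (Fin n) (Fin n) ℂ)) k l * p k * (starRingEnd ℂ) (p l))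
        = ((∑ k, ‖p k‖ ^ 2 : ℝ) : ℂ) * a z := by
      simp only [Matrix.smul_apply, Matrix.one_apply, smul_eq_mul, mul_ite, ite_mul, mul_one,
        mul_zero,
        zero_mul, Finset.sum_ite_eq, Finset.mem_univ, if_true]
      push_cast
      rw [Finset.sum_mul]
      refine Finset.sum_congr rfl fun k _ => ?_
      rw [mul_assoc, Complex.mul_conj', mul_comm]
    rw [this, Complex.re_ofReal_mul, mul_comm]
    exact mul_le_mul_of_nonneg_left (h1 z) (by positivity)
  bounded z p := by
    have : ∀ k, ∑ l, (a z • (1 : Matrix (Fin n) (Fin n) ℂ)) k l * p l = a z * p k := by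
      intro k
      simp [Matrix.one_apply]
    simp only [this, norm_mul, mul_pow]
    rw [← Finset.mul_sum]
    gcongr
    exact h2 z

/-- If the flux `Y` and the gradient `W` satisfy `Re (Y * conj W) > 0`, the quotient is an elliptic
scalar coefficient. -/
theorem exists_ellipticity {Y W : ℝ → ℂ} (hY : IsRegularProfile Y) (hW : IsRegularProfile W)
    (hpos : ∀ q ∈ Icc (0 : ℝ) 1, 0 < (Y q * (starRingEnd ℂ) (W q)).re) {d : ℝ} (hd : 0 < d) :
    ∃ lam Lam : ℝ, 0 < lam ∧ 0 < Lam ∧ ∀ q ∈ Icc (0 : ℝ) 1,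
      lam ≤ (Y q / (d * W q)).re ∧ ‖Y q / (d * W q)‖ ≤ Lam := by
  have hd' : (d : ℂ) ≠ 0 := by exact_mod_cast hd.ne'
  have hW0 : ∀ q ∈ Icc (0 : ℝ) 1, W q ≠ 0 := by
    intro q hq h
    have := hpos q hq
    simp [h] at this
  have hc : ContinuousOn (fun q => Y q / (d * W q)) (Icc 0 1) := fun q hq =>
    ((hY.continuousAt q hq).div (continuousAt_const.mul (hW.continuousAt q hq))
      (mul_ne_zero hd' (hW0 q hq))).continuousWithinAt
  obtain ⟨L, hL⟩ := isCompact_Icc.exists_bound_of_continuousOn hc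
  obtain ⟨q₀, hq₀, hmin⟩ := isCompact_Icc.exists_isMinOn (nonempty_Icc.2 zero_le_one)
    (Complex.continuous_re.comp_continuousOn hc)
  refine ⟨(Y q₀ / (d * W q₀)).re, max L 1, ?_, lt_max_of_lt_right one_pos,
    fun q hq => ⟨hmin hq, (hL q hq).trans (le_max_left _ _)⟩⟩
  have h : Y q₀ / (d * W q₀) = (((d * Complex.normSq (W q₀))⁻¹ : ℝ) : ℂ) *
      (Y q₀ * (starRingEnd ℂ) (W q₀)) := by
    have h1 := hW0 q₀ hq₀
    have h2 : (starRingEnd ℂ) (W q₀) ≠ 0 := by simpa using h1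
    push_cast [← Complex.mul_conj]
    field_simp
  rw [h, Complex.re_ofReal_mul]
  exact mul_pos (inv_pos.2 (mul_pos hd (Complex.normSq_pos.2 (hW0 q₀ hq₀)))) (hpos q₀ hq₀)

end

/-! ### The construction -/

/-- The exponent: `|x| ^ (-2 * α)` is locally in `L ^ 2` but not in `L ^ p`. -/
theorem exists_exponent {n : ℕ} (hn : 0 < n) {p : ℝ} (hp : 2 < p) :
    ∃ α ε : ℝ, 0 < α ∧ 0 < ε ∧ ε ≤ 1 ∧ (n : ℝ) = 2 * (2 * α + ε) ∧ n < 2 * α * p := by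
  have hn' : (0 : ℝ) < n := by exact_mod_cast hn
  have h1 : (n : ℝ) / p < n / 2 := div_lt_div_of_pos_left hn' two_pos hp
  have h0 : (0 : ℝ) < n / p := by positivity
  obtain ⟨ε, hε0, hε1, hε2⟩ : ∃ ε : ℝ, 0 < ε ∧ ε ≤ 1 ∧ ε ≤ (n / 2 - n / p) / 2 :=
    ⟨min 1 ((n / 2 - n / p) / 2), lt_min one_pos (by linarith), min_le_left _ _, min_le_right _ _⟩
  refine ⟨n / 4 - ε / 2, ε, by linarith, hε0, hε1, by ring, ?_⟩
  have h2 : (n : ℝ) / p < 2 * (n / 4 - ε / 2) := by linarith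
  rwa [div_lt_iff₀ (by linarith)] at h2

theorem corollary2p2 (n : ℕ) (hn : 2 ≤ n) (δ : ℝ) (hδ : 0 < δ) :
    ∃ (lam Lam : ℝ) (A : SpaceTime n → Matrix (Fin n) (Fin n) ℂ)
      (u : SpaceTime n → ℂ) (G : SpaceTime n → EuclideanSpace ℂ (Fin n)),
      0 < lam ∧ 0 < Lam ∧ IsElliptic A lam Lam ∧ IsSolution A u G ∧
      ContinuousInL2Loc u (Iio 0) ∧
      -- the norms are finite before the singular time
      (∀ t : ℝ, 0 < t →
        MemLp (fun x : Space n => u (x, -t)) (ENNReal.ofReal (2 + δ))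
          (volume.restrict (Metric.ball 0 1)) ∧
        MemLp G (ENNReal.ofReal (2 + δ))
          (volume.restrict (Metric.ball (0 : Space n) 1 ×ˢ Ioo (-1 : ℝ) (-t)))) ∧
      -- and they blow up as the time `-t` increases to `0`
      Tendsto (fun t : ℝ => eLpNorm (fun x : Space n => u (x, -t)) (ENNReal.ofReal (2 + δ))
        (volume.restrict (Metric.ball 0 1))) (𝓝[>] 0) (𝓝 ⊤) ∧
      Tendsto (fun t : ℝ => eLpNorm G (ENNReal.ofReal (2 + δ))
        (volume.restrict (Metric.ball (0 : Space n) 1 ×ˢ Ioo (-1 : ℝ) (-t))))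
        (𝓝[>] 0) (𝓝 ⊤) := by
  have hn0 : 0 < n := by omega
  have hn' : (0 : ℝ) < n := by exact_mod_cast hn0
  have hnC : (n : ℂ) ≠ 0 := by exact_mod_cast hn0.ne'
  have hp : 2 < 2 + δ := by linarith
  obtain ⟨α, ε, hα, hε, hε1, hnα, hαp⟩ := exists_exponent hn0 hp
  have hα4 : 4 * α < n := by linarith
  obtain ⟨Γ, Γ', U, U', h, hΓ0, hcoer⟩ := exists_profile hn0 hα hε hε1 hnα
  have h' := isProfile_const n α (Γ 0)
  have hcoer' := fun q => const_profile_coercive hn0 hα (by linarith) (hΓ0 0) (q := q)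
  generalize hΔ : (fun _ => Γ 0 : ℝ → ℂ) = Δ at h'
  generalize hΔ' : (fun _ => 0 : ℝ → ℂ) = Δ' at h'
  generalize hZ : (fun q : ℝ => Γ 0 - 2 / n * (1 - q) * (α * Γ 0) : ℝ → ℂ) = Z at h'
  generalize hZ' : (fun _ => 2 / n * (α * Γ 0) : ℝ → ℂ) = Z' at h'
  have rY := h.regular.backwardProfile (α := α) h.regular_deriv
  have rY' := h'.regular.forwardProfile (α := α) h'.regular_deriv
  have rW := h.regular_U.radialProfile (α := α) h.regular_derivU
  have rW' := h'.regular_U.radialProfile (α := α) h'.regular_derivU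
  have hpos' : ∀ q ∈ Icc (0 : ℝ) 1,
      0 < (forwardProfile α Δ Δ' q * (starRingEnd ℂ) (radialProfile α Z Z' q)).re := by
    intro q hq
    simpa [forwardProfile, radialProfile, ← hΔ, ← hΔ', ← hZ, ← hZ'] using hcoer' q hq
  have hd : (0 : ℝ) < 2 * n := by positivity
  obtain ⟨l₁, L₁, hl₁, hL₁, hb₁⟩ := exists_ellipticity rY rW hcoer hd
  obtain ⟨l₂, L₂, hl₂, hL₂, hb₂⟩ := exists_ellipticity rY' rW' hpos' hd
  have hW : ∀ q ∈ Icc (0 : ℝ) 1, radialProfile α U U' q ≠ 0 := by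
    intro q hq h0
    have := hcoer q hq
    rw [show -(α * U q + q * U' q) = radialProfile α U U' q from rfl, h0] at this
    simp at this
  have hW' : ∀ q ∈ Icc (0 : ℝ) 1, radialProfile α Z Z' q ≠ 0 := by
    intro q hq h0
    have := hpos' q hq
    simp [h0] at this
  -- Flux and gradient are multiples of the same real vector `x`: a scalar coefficient works.
  let a : SpaceTime n → ℂ := fun z =>
    if z.2 < 0 then (fun q => backwardProfile α Γ Γ' q / ((2 * n : ℝ) * radialProfile α U U' q))
      (timeRatio z)
    else (fun q => forwardProfile α Δ Δ' q / ((2 * n : ℝ) * radialProfile α Z Z' q)) (timeRatio z)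
  let u : SpaceTime n → ℂ := selfSimilar α U Z
  let w : SpaceTime n → ℂ := selfSimilar (α + 1) (radialProfile α U U') (radialProfile α Z Z')
  let G : SpaceTime n → EuclideanSpace ℂ (Fin n) := radialGradient w
  have ha : ∀ z, min l₁ l₂ ≤ (a z).re ∧ ‖a z‖ ≤ max L₁ L₂ := by
    intro z
    by_cases hz : z.2 < 0
    · simp only [a, if_pos hz]
      exact ⟨(min_le_left _ _).trans (hb₁ _ (timeRatio_mem z)).1,
        (hb₁ _ (timeRatio_mem z)).2.trans (le_max_left _ _)⟩
    · simp only [a, if_neg hz]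
      exact ⟨(min_le_right _ _).trans (hb₂ _ (timeRatio_mem z)).1,
        (hb₂ _ (timeRatio_mem z)).2.trans (le_max_right _ _)⟩
  have ham : Measurable a := measurable_ite_timeRatio
      (rY.measurable.div (rW.measurable.const_mul _))
    (rY'.measurable.div (rW'.measurable.const_mul _))
  have hflux : ∀ z k, a z * G z k = 1 / n * (z.1 k : ℂ)
      * selfSimilar (α + 1) (backwardProfile α Γ Γ') (forwardProfile α Δ Δ') z := by
    intro z k
    have h1 := hW _ (timeRatio_mem z)
    have h2 := hW' _ (timeRatio_mem z)
    simp only [a, G, w, radialGradient, selfSimilar]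
    push_cast
    split_ifs <;> field_simp
  obtain ⟨B, hB1, hB2⟩ := h.regular_U.exists_bound h'.regular_U
  obtain ⟨D, hD1, hD2⟩ := rW.exists_bound rW'
  have hB0 : 0 ≤ B := (norm_nonneg _).trans (hB1 0 (by simp))
  have hD0 : 0 ≤ D := (norm_nonneg _).trans (hD1 0 (by simp))
  have hum : Measurable u := measurable_selfSimilar h.measurable_U h'.measurable_U
  have hGm : Measurable G := measurable_radialGradient
      (measurable_selfSimilar rW.measurable rW'.measurable)
  have hNt : ∀ (z : SpaceTime n) {t : ℝ}, 0 < t → z.2 ≤ -t → ∀ {β : ℝ}, 0 ≤ β →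
      parabolicSq z ^ (-β) ≤ t ^ (-β) := fun z t ht hz β hβ =>
    Real.rpow_le_rpow_of_nonpos ht (by
      rw [parabolicSq, abs_of_nonpos (by linarith)]; nlinarith [sq_nonneg ‖z.1‖]) (by linarith)
  refine ⟨min l₁ l₂, max L₁ L₂, fun z => a z • 1, u, G, lt_min hl₁ hl₂, lt_max_of_lt_left hL₁,
    isElliptic_smul_one ham (fun z => (ha z).1) (fun z => (ha z).2), ⟨?_, fun φ hφ => ?_⟩, ?_,
    fun t ht => ⟨?_, ?_⟩, ?_, ?_⟩
  · exact hasWeakSpatialGradient_selfSimilar hn0 hα hα4 h.hasDerivAt_U h'.hasDerivAt_U h.regular_U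
      h'.regular_U h.regular_derivU h'.regular_derivU
  · rw [← selfSimilar_equation hn0 hα hα4 h h' (by rw [← hΔ]) hφ]
    congr 1
    ext z
    congr 1
    refine Finset.sum_congr rfl fun k _ => ?_
    rw [← hflux, ← Finset.sum_mul]
    simp [Matrix.one_apply]
  · exact continuousInL2Loc_of_continuousAt fun x t (ht : t < 0) =>
      continuousAt_selfSimilar h.regular_U.continuousAt h'.regular_U.continuousAt ht.ne
  · have : IsFiniteMeasure (volume.restrict (Metric.ball (0 : Space n) 1)) :=
      ⟨by simpa using measure_ball_lt_top⟩
    refine MemLp.of_bound (hum.comp (by fun_prop)).aestronglyMeasurable (B * t ^ (-α))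
      (Eventually.of_forall fun x => (norm_selfSimilar_le hB1 hB2 _).trans ?_)
    exact mul_le_mul_of_nonneg_left (hNt _ ht le_rfl hα.le) hB0
  · have : IsFiniteMeasure (volume.restrict (Metric.ball (0 : Space n) 1 ×ˢ Ioo (-1 : ℝ) (-t))) :=
      by
      refine ⟨?_⟩
      rw [Measure.restrict_apply_univ, Measure.volume_eq_prod, Measure.prod_prod]
      exact ENNReal.mul_lt_top measure_ball_lt_top (by simp)
    refine MemLp.of_bound hGm.aestronglyMeasurable (2 * 1 * (D * t ^ (-(α + 1)))) ?_
    filter_upwards [ae_restrict_mem (measurableSet_ball.prod measurableSet_Ioo)] with z hz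
    rw [norm_radialGradient]
    have hz1 : ‖z.1‖ ≤ 1 := (mem_ball_zero_iff.1 hz.1).le
    have hz2 : ‖w z‖ ≤ D * t ^ (-(α + 1)) := (norm_selfSimilar_le hD1 hD2 _).trans
      (mul_le_mul_of_nonneg_left (hNt _ ht hz.2.2.le (by linarith)) hD0)
    gcongr
  · refine tendsto_eLpNorm_slice_top hα (by linarith) hαp (h.regular_U.continuousAt 1 (by simp)) ?_
    simpa [h.eq] using hΓ0 1
  · obtain ⟨q₀, hq₀, hmin⟩ := isCompact_Icc.exists_isMinOn (nonempty_Icc.2 (zero_le_one (α := ℝ)))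
      (fun q hq => (rW.continuousAt q hq).norm.continuousWithinAt :
        ContinuousOn (fun q => ‖radialProfile α U U' q‖) (Icc (0 : ℝ) 1))
    exact tendsto_eLpNorm_gradient_top hn0 hα hp hαp (norm_pos_iff.2 (hW q₀ hq₀)) fun q hq =>
        hmin hq
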